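/- **Conventions.** All spaces are standard Borel. The underlying space of a finite ordered tuple of objects is the product of the underlying spaces (one point for the empty tuple). For Markov kernels $k:\mathbf A\to(\mathbf B_1,X,\mathbf B_2)$ and $l:(\mathbf C_1,X,\mathbf C_2)\to\mathbf D$, with $i=|\mathbf B_1|+1$ and $j=|\mathbf C_1|+1$, the *slotwise composite* $l\circ_{(i,j)}k:(\mathbf C_1,\mathbf A,\mathbf C_2)\to(\mathbf B_1,\mathbf D,\mathbf B_2)$ samples $(b_1,x,b_2)\sim k(\cdot\mid a)$, then $d\sim l(\cdot\mid c_1,x,c_2)$, and returns $(b_1,d,b_2)$. A *Markov polycategory* is a collection of objects with standard Borel underlying spaces together with a class of Markov kernels between tuples of objects (its morphisms) that contains all identity kernels and is closed under slotwise composition. A *color system* $(\mathcal K,\mathcal M,\iota)$ consists of a category $\mathcal K$, an ordered polycategory $\mathcal M$ with objects $\mathrm{Ob}(\mathcal K)$ (slotwise composition with the insertion convention above, satisfying the identity and associativity laws, and the interchange laws whenever both sides have the same ordered external slots), and unary morphisms $\iota(f):(c)\to(d)$ of $\mathcal M$ for the arrows $f:c\to d$ of $\mathcal K$, functorial in $f$.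 A *colored Markov polycategory* (CMP) over it is a Markov polycategory $\mathcal P$ with object colors $\chi(X)\in\mathcal K$; morphism colors $\psi(k)\in\mathrm{Hom}_{\mathcal M}(\chi(\mathbf A);\chi(\mathbf B))$ for $k:\mathbf A\to\mathbf B$, preserving identities and slotwise composition; sets $\mathrm{Int}_{\mathcal P}(B,C)\subseteq\mathcal K(\chi(B),\chi(C))$ of admissible witnesses; and, for $f\in\mathrm{Int}_{\mathcal P}(B,C)$, a morphism $\kappa_{f;B,C}:(B)\to(C)$ of $\mathcal P$ with $\psi(\kappa_{f;B,C})=\iota(f)$. It is required that $\mathrm{id}_{\chi(B)}\in\mathrm{Int}_{\mathcal P}(B,B)$ with $\kappa_{\mathrm{id};B,B}=\mathrm{id}_B$, and that $\kappa_{gf;A,C}=\kappa_{g;B,C}\circ_{(1,1)}\kappa_{f;A,B}$ whenever $f$, $g$ and $gf$ are admissible. A *CMP-functor* $G:\mathcal P\to\mathcal P'$ over the same color system consists of maps on objects and on morphisms, $k:\mathbf A\to\mathbf B$ being sent to $Gk:G\mathbf A\to G\mathbf B$, that preserve identities, slotwise composition, $\chi$ and $\psi$, and satisfy $\mathrm{Int}_{\mathcal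 P}(B,C)\subseteq\mathrm{Int}_{\mathcal P'}(GB,GC)$ and $G\kappa_{f;B,C}=\kappa'_{f;GB,GC}$. CMPs over a fixed color system and CMP-functors form a category. For $k:\mathbf A\to(\mathbf B_1,B,\mathbf B_2)$, $l:(\mathbf C_1,C,\mathbf C_2)\to\mathbf D$ and $f\in\mathrm{Int}_{\mathcal P}(B,C)$, the *colored kernel slotwise composite* (CKSC) is $l\circ^f_{(i,j)}k=l\circ_{(i,j)}(\kappa_{f;B,C}\circ_{(i,1)}k)$. A *finite acyclic CKSC diagram* $D$ in $\mathcal P$ has a finite set of vertices $u$ labelled by morphisms $k_u$, and a finite set of internal wires, each joining an output slot of a vertex (with object $B$) to an input slot of a vertex (with object $C$) and carrying a witness $f\in\mathrm{Int}_{\mathcal P}(B,C)$. Every slot lies on at most one wire, the induced directed graph on the vertices is acyclic, and orderings of the list of all external (unwired) input slots and of the list of all external output slots are chosen. Its *trace kernel* $K_D$ is computed by inserting $\kappa_{f;B,C}$ as a unary vertex on each wire, sampling all vertices successively along a topological ordering, each from its own kernel with inputs read from the external input and from the earlier outputs, and taking the marginal on the external output slots. $D$ is *CKSC-reducible* if some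 iterated CKSC expression uses every vertex of $D$ exactly once, realizes all internal wires of $D$ with their witnesses, and has as ordered lists of external slots those of $D$. The value of such an expression is written $\langle D\rangle_{\mathcal P}$. For a CMP-functor $G$, the diagram $GD$ is obtained by applying $G$ to all vertex labels and leaving the wires, the witnesses and the orderings of the external slots unchanged. **Proposition.** Let $G:\mathcal P\to\mathcal P'$ be a CMP-functor and let $D$ be a CKSC-reducible finite acyclic CKSC diagram in $\mathcal P$. Then $\langle D\rangle_{\mathcal P}$ does not depend on the chosen expression, $GD$ is CKSC-reducible in $\mathcal P'$, and $$G\langle D\rangle_{\mathcal P}=\langle GD\rangle_{\mathcal P'}.$$ Consequently, the Markov kernel underlying $G\langle D\rangle_{\mathcal P}$ is the trace kernel $K_{GD}$, for every topological ordering used to evaluate the latter. Moreover, let $F:\mathcal T\to\mathbf{CMP}$ be a functor from a category $\mathcal T$ to the category of CMPs over the color system, and write $\alpha_{!}=F(\alpha)$. For every finite acyclic CKSC diagram $D$ in $F(t)$ and all $\alpha:t\to t'$ and $\beta:t'\to t''$ one has $(\mathrm{id}_t)_!D=D$ and $(\beta\circ\alpha)_!D=\beta_!(\alpha_!D)$.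 If $D$ is CKSC-reducible, then so is $\alpha_!D$, and $\alpha_!\langle D\rangle_{F(t)}=\langle\alpha_!D\rangle_{F(t')}$. -/

import Mathlib

open CategoryTheory

universe uO uS uK vK uM uD uT vT

namespace ColoredMarkov

/-! ## Tuples of objects and Markov kernels between them -/

section Tuples

variable {Ob : Type uO}

/-- The underlying space of an ordered tuple of objects: the product of the underlying spaces,
a one-point space for the empty tuple. -/
def Tuple (S : Ob → Type uS) : List Ob → Type uS
  | [] => PUnit
  | X :: L => S X × Tuple S L

/-- The product σ-algebra. -/
instance Tuple.instMeasurableSpace (S : Ob → Type uS) [∀ X, MeasurableSpace (S X)] :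
    ∀ L : List Ob, MeasurableSpace (Tuple S L)
  | [] => inferInstanceAs (MeasurableSpace PUnit)
  | X :: L =>
    letI := Tuple.instMeasurableSpace S L
    inferInstanceAs (MeasurableSpace (S X × Tuple S L))

variable {S : Ob → Type uS}

/-- The tuple of the first entries of a concatenated tuple. -/
def Tuple.left : ∀ {L₁ L₂ : List Ob}, Tuple S (L₁ ++ L₂) → Tuple S L₁
  | [], _, _ => PUnit.unit
  | _ :: _, _, t => (t.1, Tuple.left t.2)

/-- The tuple of the last entries of a concatenated tuple. -/
def Tuple.right : ∀ {L₁ L₂ : List Ob}, Tuple S (L₁ ++ L₂) → Tuple S L₂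
  | [], _, t => t
  | _ :: L₁, _, t => Tuple.right (L₁ := L₁) t.2

/-- Concatenation of tuples. -/
def Tuple.append : ∀ {L₁ L₂ : List Ob}, Tuple S L₁ → Tuple S L₂ → Tuple S (L₁ ++ L₂)
  | [], _, _, t => t
  | _ :: _, _, s, t => (s.1, Tuple.append s.2 t)

/-- The entry in position `p` (counted from `0`). -/
def Tuple.get : ∀ {L : List Ob}, Tuple S L → ∀ (p : ℕ) (h : p < L.length), S L[p]
  | _ :: _, t, 0, _ => t.1
  | _ :: _, t, p + 1, h => Tuple.get t.2 p (Nat.lt_of_succ_lt_succ h)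

/-- The tuple with given entries. -/
def Tuple.ofFn : ∀ {L : List Ob}, (∀ (p : ℕ) (h : p < L.length), S L[p]) → Tuple S L
  | [], _ => PUnit.unit
  | _ :: _, f => (f 0 (Nat.succ_pos _), Tuple.ofFn fun p h => f (p + 1) (Nat.succ_lt_succ h))

/-- Identification of the underlying spaces of two equal objects. -/
def recast {X Y : Ob} (e : X = Y) (s : S X) : S Y := e ▸ s

variable [∀ X, MeasurableSpace (S X)]

theorem Tuple.measurable_left : ∀ {L₁ L₂ : List Ob},
    Measurable (Tuple.left : Tuple S (L₁ ++ L₂) → Tuple S L₁)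
  | [], _ => measurable_const
  | _ :: L₁, _ => measurable_fst.prodMk ((Tuple.measurable_left (L₁ := L₁)).comp measurable_snd)

theorem Tuple.measurable_right : ∀ {L₁ L₂ : List Ob},
    Measurable (Tuple.right : Tuple S (L₁ ++ L₂) → Tuple S L₂)
  | [], _ => measurable_id
  | _ :: L₁, _ => (Tuple.measurable_right (L₁ := L₁)).comp measurable_snd

theorem Tuple.measurable_append : ∀ {L₁ L₂ : List Ob},
    Measurable (fun z : Tuple S L₁ × Tuple S L₂ => Tuple.append z.1 z.2)
  | [], _ => measurable_snd
  | _ :: L₁, _ =>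
    (measurable_fst.comp measurable_fst).prodMk ((Tuple.measurable_append (L₁ := L₁)).comp
      ((measurable_snd.comp measurable_fst).prodMk measurable_snd))

theorem Tuple.measurable_get : ∀ {L : List Ob} (p : ℕ) (h : p < L.length),
    Measurable (fun t : Tuple S L => t.get p h)
  | _ :: _, 0, _ => measurable_fst
  | _ :: _, p + 1, h => (Tuple.measurable_get p (Nat.lt_of_succ_lt_succ h)).comp measurable_snd

theorem Tuple.measurable_ofFn {α : Type*} [MeasurableSpace α] : ∀ {L : List Ob}
    {f : α → ∀ (p : ℕ) (h : p < L.length), S L[p]},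
    (∀ p h, Measurable fun a => f a p h) → Measurable fun a => Tuple.ofFn (f a)
  | [], _, _ => measurable_const
  | _ :: _, _, hf => (hf 0 (Nat.succ_pos _)).prodMk
      (Tuple.measurable_ofFn fun p h => hf (p + 1) (Nat.succ_lt_succ h))

theorem measurable_recast {X Y : Ob} (e : X = Y) :
    Measurable (recast e : S X → S Y) := by
  subst e
  exact measurable_id

variable (S) in
/-- A Markov kernel between ordered tuples of objects, together with its input profile `dom` and
its output profile `cod`. Two of them are equal iff the profiles and the kernels agree. -/
structure TupleKernel where
  dom : List Ob
  cod : List Ob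
  ker : ProbabilityTheory.Kernel (Tuple S dom) (Tuple S cod)
  markov : ProbabilityTheory.IsMarkovKernel ker

attribute [instance] TupleKernel.markov

/-- The identity (Dirac) kernel of an object. -/
noncomputable def TupleKernel.id (X : Ob) : TupleKernel S :=
  ⟨[X], [X], ProbabilityTheory.Kernel.id, inferInstance⟩

/-- The input `T_j(c₋ⱼ, π_i(b))` of the second kernel in a slotwise composite, as a function of the
input `V_j(a, c₋ⱼ)` of the composite and the output `b` of the first kernel. -/
def kscInput {A B₁ B₂ C₁ C₂ : List Ob} {X : Ob}
    (z : Tuple S (C₁ ++ (A ++ C₂)) × Tuple S (B₁ ++ X :: B₂)) : Tuple S (C₁ ++ X :: C₂) :=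
  Tuple.append z.1.left
    (show Tuple S (X :: C₂) from
      ((show S X × Tuple S B₂ from z.2.right).1, Tuple.right (L₁ := A) z.1.right))

/-- The output `U_i(π₋ᵢ(b), d)` of a slotwise composite. -/
def kscOutput {B₁ B₂ D : List Ob} {X : Ob}
    (z : Tuple S (B₁ ++ X :: B₂) × Tuple S D) : Tuple S (B₁ ++ (D ++ B₂)) :=
  Tuple.append z.1.left (Tuple.append z.2 (show S X × Tuple S B₂ from z.1.right).2)

theorem measurable_kscInput {A B₁ B₂ C₁ C₂ : List Ob} {X : Ob} :
    Measurable (kscInput (S := S) (A := A) (B₁ := B₁) (B₂ := B₂) (C₁ := C₁) (C₂ := C₂) (X := X)) := by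
  refine Tuple.measurable_append.comp (Measurable.prodMk
    (Tuple.measurable_left.comp measurable_fst) ?_)
  refine Measurable.prodMk (measurable_fst.comp (Tuple.measurable_right.comp measurable_snd)) ?_
  exact Tuple.measurable_right.comp (Tuple.measurable_right.comp measurable_fst)

theorem measurable_kscOutput {B₁ B₂ D : List Ob} {X : Ob} :
    Measurable (kscOutput (S := S) (B₁ := B₁) (B₂ := B₂) (D := D) (X := X)) := by
  refine Tuple.measurable_append.comp (Measurable.prodMk
    (Tuple.measurable_left.comp measurable_fst) ?_)
  exact Tuple.measurable_append.comp (Measurable.prodMk measurable_snd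
    (measurable_snd.comp (Tuple.measurable_right.comp measurable_fst)))

/-- Slotwise composition of kernels `k : A → (B₁, X, B₂)` and `l : (C₁, X, C₂) → D`:
sample `b ∼ k(· ∣ a)`, then `d ∼ l(· ∣ c₁, b_X, c₂)`, and return `(b₁, d, b₂)`. -/
noncomputable def kscKernel {A B₁ B₂ C₁ C₂ D : List Ob} {X : Ob}
    (l : ProbabilityTheory.Kernel (Tuple S (C₁ ++ X :: C₂)) (Tuple S D))
    (k : ProbabilityTheory.Kernel (Tuple S A) (Tuple S (B₁ ++ X :: B₂))) :
    ProbabilityTheory.Kernel (Tuple S (C₁ ++ (A ++ C₂))) (Tuple S (B₁ ++ (D ++ B₂))) :=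
  ((k.comap (fun t : Tuple S (C₁ ++ (A ++ C₂)) => t.right.left)
      (Tuple.measurable_left.comp Tuple.measurable_right)).compProd
    (l.comap kscInput measurable_kscInput)).map kscOutput

instance {A B₁ B₂ C₁ C₂ D : List Ob} {X : Ob}
    (l : ProbabilityTheory.Kernel (Tuple S (C₁ ++ X :: C₂)) (Tuple S D))
    (k : ProbabilityTheory.Kernel (Tuple S A) (Tuple S (B₁ ++ X :: B₂)))
    [ProbabilityTheory.IsMarkovKernel l] [ProbabilityTheory.IsMarkovKernel k] :
    ProbabilityTheory.IsMarkovKernel (kscKernel l k) :=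
  ProbabilityTheory.Kernel.IsMarkovKernel.map _ measurable_kscOutput

/-- Kernel slotwise composition `l ∘_(i,j) k`. The slot pair `(i, j)` is given by the
decompositions `cod k = (B₁, X, B₂)` and `dom l = (C₁, X, C₂)`, that is `i = |B₁| + 1` and
`j = |C₁| + 1`. -/
noncomputable def TupleKernel.comp (l k : TupleKernel S) (B₁ : List Ob) (X : Ob)
    (B₂ C₁ C₂ : List Ob) (hk : k.cod = B₁ ++ X :: B₂) (hl : l.dom = C₁ ++ X :: C₂) :
    TupleKernel S :=
  match k, l, hk, hl with
  | ⟨A, _, k, _⟩, ⟨_, D, l, _⟩, rfl, rfl =>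
    ⟨C₁ ++ (A ++ C₂), B₁ ++ (D ++ B₂), kscKernel l k, inferInstance⟩

theorem TupleKernel.dom_comp (l k : TupleKernel S) (B₁ : List Ob) (X : Ob)
    (B₂ C₁ C₂ : List Ob) (hk : k.cod = B₁ ++ X :: B₂) (hl : l.dom = C₁ ++ X :: C₂) :
    (l.comp k B₁ X B₂ C₁ C₂ hk hl).dom = C₁ ++ (k.dom ++ C₂) := by
  obtain ⟨A, _, k, _⟩ := k
  obtain ⟨_, D, l, _⟩ := l
  cases hk
  cases hl
  rfl

theorem TupleKernel.cod_comp (l k : TupleKernel S) (B₁ : List Ob) (X : Ob)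
    (B₂ C₁ C₂ : List Ob) (hk : k.cod = B₁ ++ X :: B₂) (hl : l.dom = C₁ ++ X :: C₂) :
    (l.comp k B₁ X B₂ C₁ C₂ hk hl).cod = B₁ ++ (l.cod ++ B₂) := by
  obtain ⟨A, _, k, _⟩ := k
  obtain ⟨_, D, l, _⟩ := l
  cases hk
  cases hl
  rfl

end Tuples

/-! ## Ordered polycategories and color systems -/

/-- An ordered polycategory with object collection `Ob`. `Hom(A; B)` consists of the `k : Mor` with
`dom k = A` and `cod k = B`. The composite `comp l k B₁ X B₂ C₁ C₂` connects the output slot `X` of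
`k : A → (B₁, X, B₂)` to the input slot `X` of `l : (C₁, X, C₂) → D`. The interchange laws are
imposed whenever the two sides have the same ordered external slots. -/
structure OrderedPolycategory (Ob : Type uO) where
  Mor : Type uM
  dom : Mor → List Ob
  cod : Mor → List Ob
  id : Ob → Mor
  dom_id : ∀ X, dom (id X) = [X]
  cod_id : ∀ X, cod (id X) = [X]
  comp : ∀ (l k : Mor) (B₁ : List Ob) (X : Ob) (B₂ C₁ C₂ : List Ob),
    cod k = B₁ ++ X :: B₂ → dom l = C₁ ++ X :: C₂ → Mor
  dom_comp : ∀ l k B₁ X B₂ C₁ C₂ hk hl,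
    dom (comp l k B₁ X B₂ C₁ C₂ hk hl) = C₁ ++ (dom k ++ C₂)
  cod_comp : ∀ l k B₁ X B₂ C₁ C₂ hk hl,
    cod (comp l k B₁ X B₂ C₁ C₂ hk hl) = B₁ ++ (cod l ++ B₂)
  id_comp : ∀ k B₁ X B₂ hk hl, comp (id X) k B₁ X B₂ [] [] hk hl = k
  comp_id : ∀ l X C₁ C₂ hk hl, comp l (id X) [] X [] C₁ C₂ hk hl = l
  assoc : ∀ (m l k : Mor) (X Y : Ob) (B₁ B₂ C₁ C₂ D₁ D₂ E₁ E₂ : List Ob)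
    (hk : cod k = B₁ ++ X :: B₂) (hl : dom l = C₁ ++ X :: C₂)
    (hl' : cod l = D₁ ++ Y :: D₂) (hm : dom m = E₁ ++ Y :: E₂)
    (h₁ : cod (comp l k B₁ X B₂ C₁ C₂ hk hl) = (B₁ ++ D₁) ++ Y :: (D₂ ++ B₂))
    (h₂ : dom (comp m l D₁ Y D₂ E₁ E₂ hl' hm) = (E₁ ++ C₁) ++ X :: (C₂ ++ E₂)),
    comp m (comp l k B₁ X B₂ C₁ C₂ hk hl) (B₁ ++ D₁) Y (D₂ ++ B₂) E₁ E₂ h₁ hm =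
      comp (comp m l D₁ Y D₂ E₁ E₂ hl' hm) k B₁ X B₂ (E₁ ++ C₁) (C₂ ++ E₂) hk h₂
  interchange_out : ∀ (l m k : Mor) (X Y : Ob) (B₁ B₂ B₃ C₁ C₂ E₁ E₂ : List Ob)
    (hk : cod k = B₁ ++ X :: (B₂ ++ Y :: B₃)) (hk' : cod k = (B₁ ++ X :: B₂) ++ Y :: B₃)
    (hl : dom l = C₁ ++ X :: C₂) (hm : dom m = E₁ ++ Y :: E₂)
    (h₁ : cod (comp l k B₁ X (B₂ ++ Y :: B₃) C₁ C₂ hk hl) = (B₁ ++ (cod l ++ B₂)) ++ Y :: B₃)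
    (h₂ : cod (comp m k (B₁ ++ X :: B₂) Y B₃ E₁ E₂ hk' hm) = B₁ ++ X :: (B₂ ++ (cod m ++ B₃))),
    (C₁ = [] ∨ E₁ = []) → (C₂ = [] ∨ E₂ = []) →
    comp m (comp l k B₁ X (B₂ ++ Y :: B₃) C₁ C₂ hk hl) (B₁ ++ (cod l ++ B₂)) Y B₃ E₁ E₂ h₁ hm =
      comp l (comp m k (B₁ ++ X :: B₂) Y B₃ E₁ E₂ hk' hm) B₁ X (B₂ ++ (cod m ++ B₃)) C₁ C₂ h₂ hl
  interchange_in : ∀ (l k m : Mor) (X Y : Ob) (A₁ A₂ A₃ B₁ B₂ E₁ E₂ : List Ob)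
    (hl : dom l = A₁ ++ X :: (A₂ ++ Y :: A₃)) (hl' : dom l = (A₁ ++ X :: A₂) ++ Y :: A₃)
    (hk : cod k = B₁ ++ X :: B₂) (hm : cod m = E₁ ++ Y :: E₂)
    (h₁ : dom (comp l k B₁ X B₂ A₁ (A₂ ++ Y :: A₃) hk hl) = (A₁ ++ (dom k ++ A₂)) ++ Y :: A₃)
    (h₂ : dom (comp l m E₁ Y E₂ (A₁ ++ X :: A₂) A₃ hm hl') = A₁ ++ X :: (A₂ ++ (dom m ++ A₃))),
    (B₁ = [] ∨ E₁ = []) → (B₂ = [] ∨ E₂ = []) →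
    comp (comp l k B₁ X B₂ A₁ (A₂ ++ Y :: A₃) hk hl) m E₁ Y E₂ (A₁ ++ (dom k ++ A₂)) A₃ hm h₁ =
      comp (comp l m E₁ Y E₂ (A₁ ++ X :: A₂) A₃ hm hl') k B₁ X B₂ A₁ (A₂ ++ (dom m ++ A₃)) hk h₂

/-- A color system: an object-color category `K`, an ordered polycategory of morphism colors on the
objects of `K`, and a functorial assignment `ι` of unary morphism colors to the arrows of `K`. -/
structure ColorSystem (K : Type uK) [Category.{vK} K] where
  M : OrderedPolycategory.{uK, uM} K
  ι : ∀ {c d : K}, (c ⟶ d) → M.Mor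
  dom_ι : ∀ {c d : K} (f : c ⟶ d), M.dom (ι f) = [c]
  cod_ι : ∀ {c d : K} (f : c ⟶ d), M.cod (ι f) = [d]
  ι_id : ∀ c : K, ι (𝟙 c) = M.id c
  ι_comp : ∀ {c d e : K} (f : c ⟶ d) (g : d ⟶ e),
    ι (f ≫ g) = M.comp (ι g) (ι f) [] d [] [] [] (cod_ι f) (dom_ι g)

/-! ## Markov polycategories and colored Markov polycategories -/

/-- A Markov polycategory: objects with standard Borel underlying spaces, and a class of Markov
kernels between tuples of objects that contains the identity kernels and is closed under kernel
slotwise composition. -/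
structure MarkovPolycategory where
  Ob : Type uO
  space : Ob → Type uS
  [measurableSpace : ∀ X, MeasurableSpace (space X)]
  [standardBorel : ∀ X, StandardBorelSpace (space X)]
  IsMor : TupleKernel space → Prop
  isMor_id : ∀ X, IsMor (TupleKernel.id X)
  isMor_comp : ∀ (l k : TupleKernel space) B₁ X B₂ C₁ C₂ hk hl, IsMor l → IsMor k →
    IsMor (l.comp k B₁ X B₂ C₁ C₂ hk hl)

attribute [instance] MarkovPolycategory.measurableSpace MarkovPolycategory.standardBorel

namespace MarkovPolycategory

variable (P : MarkovPolycategory.{uO, uS})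

/-- The morphisms of a Markov polycategory (with all profiles). -/
def Mor : Type (max uO uS) := {k : TupleKernel P.space // P.IsMor k}

variable {P}

/-- The Markov kernel underlying a morphism. -/
abbrev Mor.toKernel (k : P.Mor) : TupleKernel P.space := k.1

/-- The input profile of a morphism. -/
abbrev Mor.dom (k : P.Mor) : List P.Ob := k.toKernel.dom

/-- The output profile of a morphism. -/
abbrev Mor.cod (k : P.Mor) : List P.Ob := k.toKernel.cod

/-- The Markov kernel underlying a morphism, without its profiles. -/
abbrev Mor.ker (k : P.Mor) : ProbabilityTheory.Kernel (Tuple P.space k.dom) (Tuple P.space k.cod) :=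
  k.toKernel.ker

instance (k : P.Mor) : ProbabilityTheory.IsMarkovKernel k.ker := k.toKernel.markov

variable (P) in
/-- Identity morphisms. -/
noncomputable def idMor (X : P.Ob) : P.Mor := ⟨TupleKernel.id X, P.isMor_id X⟩

/-- Slotwise composition `l ∘_(i,j) k` of morphisms. -/
noncomputable def Mor.comp (l k : P.Mor) (B₁ : List P.Ob) (X : P.Ob) (B₂ C₁ C₂ : List P.Ob)
    (hk : k.cod = B₁ ++ X :: B₂) (hl : l.dom = C₁ ++ X :: C₂) : P.Mor :=
  ⟨l.toKernel.comp k.toKernel B₁ X B₂ C₁ C₂ hk hl, P.isMor_comp _ _ _ _ _ _ _ _ _ l.2 k.2⟩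

theorem Mor.cod_comp (l k : P.Mor) (B₁ : List P.Ob) (X : P.Ob) (B₂ C₁ C₂ : List P.Ob)
    (hk : k.cod = B₁ ++ X :: B₂) (hl : l.dom = C₁ ++ X :: C₂) :
    (l.comp k B₁ X B₂ C₁ C₂ hk hl).cod = B₁ ++ (l.cod ++ B₂) :=
  TupleKernel.cod_comp _ _ _ _ _ _ _ _ _

end MarkovPolycategory

/-- A colored Markov polycategory over a color system: a Markov polycategory with object colors `χ`,
morphism colors `ψ`, and an interface system. `Int B C` is the set of admissible witnesses, a set of
arrows `χ B ⟶ χ C` of `K`, and `κ B C f` is the interface kernel of the witness `f`. Interface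
kernels respect composition of witnesses as soon as the composite is admissible; closure of the
admissible witnesses under composition is allowed but not required. -/
structure CMP {K : Type uK} [Category.{vK} K] (𝒞 : ColorSystem.{uK, vK, uM} K) extends
    MarkovPolycategory.{uO, uS} where
  χ : Ob → K
  ψ : toMarkovPolycategory.Mor → 𝒞.M.Mor
  dom_ψ : ∀ k, 𝒞.M.dom (ψ k) = k.dom.map χ
  cod_ψ : ∀ k, 𝒞.M.cod (ψ k) = k.cod.map χ
  ψ_id : ∀ X, ψ (toMarkovPolycategory.idMor X) = 𝒞.M.id (χ X)
  ψ_comp : ∀ (l k : toMarkovPolycategory.Mor) B₁ X B₂ C₁ C₂ hk hl,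
    ψ (l.comp k B₁ X B₂ C₁ C₂ hk hl) =
      𝒞.M.comp (ψ l) (ψ k) (B₁.map χ) (χ X) (B₂.map χ) (C₁.map χ) (C₂.map χ)
        (by rw [cod_ψ, hk]; simp) (by rw [dom_ψ, hl]; simp)
  Int : Ob → Ob → Set (Arrow K)
  int_left : ∀ {B C f}, f ∈ Int B C → f.left = χ B
  int_right : ∀ {B C f}, f ∈ Int B C → f.right = χ C
  κ : ∀ (B C : Ob) (f : Arrow K), f ∈ Int B C → toMarkovPolycategory.Mor
  dom_κ : ∀ B C f hf, (κ B C f hf).dom = [B]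
  cod_κ : ∀ B C f hf, (κ B C f hf).cod = [C]
  ψ_κ : ∀ B C f hf, ψ (κ B C f hf) = 𝒞.ι f.hom
  id_mem_int : ∀ B, Arrow.mk (𝟙 (χ B)) ∈ Int B B
  κ_id : ∀ B, κ B B (Arrow.mk (𝟙 (χ B))) (id_mem_int B) = toMarkovPolycategory.idMor B
  κ_comp : ∀ (A B C : Ob) (f : χ A ⟶ χ B) (g : χ B ⟶ χ C) (hf : Arrow.mk f ∈ Int A B)
    (hg : Arrow.mk g ∈ Int B C) (hfg : Arrow.mk (f ≫ g) ∈ Int A C),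
    κ A C (Arrow.mk (f ≫ g)) hfg =
      (κ B C (Arrow.mk g) hg).comp (κ A B (Arrow.mk f) hf) [] B [] [] []
        (cod_κ _ _ _ hf) (dom_κ _ _ _ hg)

section CMP

variable {K : Type uK} [Category.{vK} K] {𝒞 : ColorSystem.{uK, vK, uM} K}

namespace CMP

variable {P : CMP.{uO, uS} 𝒞}

/-- Colored kernel slotwise composition
`l ∘^f_(i,j) k = l ∘_(i,j) (κ_f ∘_(i,1) k)` of `k : A → (B₁, B, B₂)` and `l : (C₁, C, C₂) → D` along
the admissible witness `f ∈ Int B C`. -/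
noncomputable def cksc (l k : P.Mor) (B₁ : List P.Ob) (B : P.Ob) (B₂ C₁ : List P.Ob) (C : P.Ob)
    (C₂ : List P.Ob) (hk : k.cod = B₁ ++ B :: B₂) (hl : l.dom = C₁ ++ C :: C₂)
    (f : Arrow K) (hf : f ∈ P.Int B C) : P.Mor :=
  l.comp ((P.κ B C f hf).comp k B₁ B B₂ [] [] hk (P.dom_κ B C f hf)) B₁ C B₂ C₁ C₂
    (by rw [MarkovPolycategory.Mor.cod_comp, P.cod_κ]; rfl) hl

end CMP

/-- A CMP-functor over a fixed color system: maps on objects and on morphisms that preserve profiles,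
identities, slotwise composition, colors, admissible witnesses and interface kernels. -/
@[ext]
structure CMPFunctor (P P' : CMP.{uO, uS} 𝒞) where
  obj : P.Ob → P'.Ob
  map : P.Mor → P'.Mor
  dom_map : ∀ k, (map k).dom = k.dom.map obj
  cod_map : ∀ k, (map k).cod = k.cod.map obj
  map_id : ∀ X, map (P.idMor X) = P'.idMor (obj X)
  map_comp : ∀ (l k : P.Mor) B₁ X B₂ C₁ C₂ hk hl,
    map (l.comp k B₁ X B₂ C₁ C₂ hk hl) =
      (map l).comp (map k) (B₁.map obj) (obj X) (B₂.map obj) (C₁.map obj) (C₂.map obj)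
        (by rw [cod_map, hk]; simp) (by rw [dom_map, hl]; simp)
  χ_obj : ∀ X, P'.χ (obj X) = P.χ X
  ψ_map : ∀ k, P'.ψ (map k) = P.ψ k
  int_obj : ∀ {B C f}, f ∈ P.Int B C → f ∈ P'.Int (obj B) (obj C)
  map_κ : ∀ B C f (hf : f ∈ P.Int B C), map (P.κ B C f hf) = P'.κ (obj B) (obj C) f (int_obj hf)

/-- The category of CMPs over a fixed color system. -/
instance : Category (CMP.{uO, uS} 𝒞) where
  Hom := CMPFunctor
  id P :=
    { obj := fun X => X
      map := fun k => k
      dom_map := by simp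
      cod_map := by simp
      map_id := fun _ => rfl
      map_comp := by intros; simp
      χ_obj := fun _ => rfl
      ψ_map := fun _ => rfl
      int_obj := fun h => h
      map_κ := fun _ _ _ _ => rfl }
  comp G H :=
    { obj := fun X => H.obj (G.obj X)
      map := fun k => H.map (G.map k)
      dom_map := fun k => by rw [H.dom_map, G.dom_map, List.map_map]; rfl
      cod_map := fun k => by rw [H.cod_map, G.cod_map, List.map_map]; rfl
      map_id := fun X => by rw [G.map_id, H.map_id]
      map_comp := by
        intro l k B₁ X B₂ C₁ C₂ hk hl
        rw [G.map_comp, H.map_comp]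
        simp only [List.map_map]
        rfl
      χ_obj := fun X => by rw [H.χ_obj, G.χ_obj]
      ψ_map := fun k => by rw [H.ψ_map, G.ψ_map]
      int_obj := fun h => H.int_obj (G.int_obj h)
      map_κ := fun B C f hf => by rw [G.map_κ, H.map_κ] }

/-- The action of a morphism of CMPs, as a CMP-functor, on morphisms. -/
def CMP.mapMor {P P' : CMP.{uO, uS} 𝒞} (G : P ⟶ P') (k : P.Mor) : P'.Mor := CMPFunctor.map G k

end CMP

/-! ## Finite acyclic KSC diagrams and their trace kernels -/

/-- A finite acyclic KSC diagram: finite sets `V` of vertices and `W` of internal wires. The slot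
`(u, p)` is the `p`-th input or output slot of the vertex `u`, with `p` counted from `0`. -/
structure KSCDiagram (P : MarkovPolycategory.{uO, uS}) where
  V : Type uD
  W : Type uD
  [fintypeV : Fintype V]
  [fintypeW : Fintype W]
  label : V → P.Mor
  src : W → V × ℕ
  tgt : W → V × ℕ
  src_lt : ∀ w, (src w).2 < (label (src w).1).cod.length
  tgt_lt : ∀ w, (tgt w).2 < (label (tgt w).1).dom.length
  obj_eq : ∀ w, (label (src w).1).cod[(src w).2]'(src_lt w) =
    (label (tgt w).1).dom[(tgt w).2]'(tgt_lt w)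
  src_injective : Function.Injective src
  tgt_injective : Function.Injective tgt
  acyclic : ∀ v, ¬ Relation.TransGen (fun a b => ∃ w, (src w).1 = a ∧ (tgt w).1 = b) v v
  ins : List (V × ℕ)
  outs : List (V × ℕ)
  nodup_ins : ins.Nodup
  nodup_outs : outs.Nodup
  mem_ins : ∀ s, s ∈ ins ↔ s.2 < (label s.1).dom.length ∧ ∀ w, tgt w ≠ s
  mem_outs : ∀ s, s ∈ outs ↔ s.2 < (label s.1).cod.length ∧ ∀ w, src w ≠ s

attribute [instance] KSCDiagram.fintypeV KSCDiagram.fintypeW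

namespace KSCDiagram

variable {P : MarkovPolycategory.{uO, uS}} (D : KSCDiagram.{uO, uS, uD} P)

/-- The external input profile. -/
def inProfile : List P.Ob :=
  D.ins.pmap (fun s hs => (D.label s.1).dom[s.2]'hs) fun s hs => ((D.mem_ins s).1 hs).1

/-- The external output profile. -/
def outProfile : List P.Ob :=
  D.outs.pmap (fun s hs => (D.label s.1).cod[s.2]'hs) fun s hs => ((D.mem_outs s).1 hs).1

/-- `us` enumerates vertices without repetition, latest vertex first, such that every vertex comes
after all its predecessors, which are also in the list. -/
def IsInitial : List D.V → Prop
  | [] => True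
  | v :: us => v ∉ us ∧ (∀ w, (D.tgt w).1 = v → (D.src w).1 ∈ us) ∧ IsInitial us

/-- Topological orderings of the vertex set, written with the latest vertex first. -/
def IsTopologicalOrder (us : List D.V) : Prop := D.IsInitial us ∧ ∀ v, v ∈ us

/-- Values of all output slots of the vertices in `us`: the labelled product `∏_{u ∈ us} B_u`. -/
abbrev Outputs (us : List D.V) : Type (max uD uS) :=
  ∀ u : {u // u ∈ us}, Tuple P.space (D.label u.1).cod

open Classical in
/-- The input tuple of the vertex `v`, read off the external input and the outputs of the earlier
vertices: a wired input slot carries the value of the output slot it is connected to, an external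
input slot carries the corresponding entry of the external input. -/
noncomputable def readInput (v : D.V) (us : List D.V)
    (h : ∀ w, (D.tgt w).1 = v → (D.src w).1 ∈ us)
    (z : Tuple P.space D.inProfile × D.Outputs us) : Tuple P.space (D.label v).dom :=
  Tuple.ofFn fun q hq =>
    if hw : ∃ w, D.tgt w = (v, q) then
      recast (by
          rw [D.obj_eq hw.choose]
          have := hw.choose_spec
          congr! 3 <;> rw [this])
        ((z.2 ⟨(D.src hw.choose).1, h _ (by rw [hw.choose_spec])⟩).get (D.src hw.choose).2
          (D.src_lt hw.choose))
    else
      have hs : D.ins.idxOf (v, q) < D.ins.length :=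
        List.idxOf_lt_length_of_mem ((D.mem_ins (v, q)).2 ⟨hq, not_exists.1 hw⟩)
      recast (by simp [inProfile])
        (z.1.get (D.ins.idxOf (v, q)) (by simpa [inProfile] using hs))

open Classical in
/-- Adjoin the output tuple of the vertex `v`. -/
noncomputable def extendOutputs (v : D.V) (us : List D.V)
    (z : D.Outputs us × Tuple P.space (D.label v).cod) : D.Outputs (v :: us) :=
  fun u =>
    if hu : v = u.1 then cast (congrArg (fun v => Tuple P.space (D.label v).cod) hu) z.2
    else z.1 ⟨u.1, (List.mem_cons.1 u.2).resolve_left fun h => hu h.symm⟩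

theorem measurable_readInput (v : D.V) (us : List D.V)
    (h : ∀ w, (D.tgt w).1 = v → (D.src w).1 ∈ us) : Measurable (D.readInput v us h) := by
  refine Tuple.measurable_ofFn fun q hq => ?_
  by_cases hw : ∃ w, D.tgt w = (v, q)
  · simp only [hw, dite_true]
    exact (measurable_recast _).comp ((Tuple.measurable_get _ _).comp
      ((measurable_pi_apply _).comp measurable_snd))
  · simp only [hw, dite_false]
    exact (measurable_recast _).comp ((Tuple.measurable_get _ _).comp measurable_fst)

theorem measurable_extendOutputs (v : D.V) (us : List D.V) :
    Measurable (D.extendOutputs v us) := by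
  refine measurable_pi_iff.2 fun u => ?_
  obtain ⟨u, hu⟩ := u
  by_cases h : v = u
  · subst h
    simp only [extendOutputs, dite_true]
    exact measurable_snd
  · simp only [extendOutputs, h, dite_false]
    exact (measurable_pi_apply _).comp measurable_fst

/-- The trace kernel of the vertices in `us` as a conditional law of all their outputs given the
external input: the vertices are sampled successively, each from its own kernel. -/
noncomputable def traceLaw : ∀ us : List D.V, D.IsInitial us →
    ProbabilityTheory.Kernel (Tuple P.space D.inProfile) (D.Outputs us)
  | [], _ => ProbabilityTheory.Kernel.deterministic
      (fun _ u => absurd u.2 List.not_mem_nil) measurable_const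
  | v :: us, h => ((traceLaw us h.2.2).compProd
      ((D.label v).ker.comap (D.readInput v us h.2.1)
        (D.measurable_readInput v us h.2.1))).map (D.extendOutputs v us)

theorem isMarkovKernel_traceLaw : ∀ (us : List D.V) (h : D.IsInitial us),
    ProbabilityTheory.IsMarkovKernel (D.traceLaw us h)
  | [], _ => by unfold traceLaw; infer_instance
  | v :: us, h => by
    have := isMarkovKernel_traceLaw us h.2.2
    unfold traceLaw
    exact ProbabilityTheory.Kernel.IsMarkovKernel.map _ (D.measurable_extendOutputs v us)

/-- The external output tuple, read off the outputs of all vertices. -/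
def readOutput (us : List D.V) (h : ∀ v, v ∈ us) (y : D.Outputs us) :
    Tuple P.space D.outProfile :=
  Tuple.ofFn fun p hp =>
    have hp' : p < D.outs.length := by simpa [outProfile] using hp
    recast (by simp [outProfile])
      ((y ⟨(D.outs[p]).1, h _⟩).get (D.outs[p]).2
        ((D.mem_outs _).1 (List.getElem_mem hp')).1)

theorem measurable_readOutput (us : List D.V) (h : ∀ v, v ∈ us) :
    Measurable (D.readOutput us h) :=
  Tuple.measurable_ofFn fun _ _ => (measurable_recast _).comp ((Tuple.measurable_get _ _).comp
    (measurable_pi_apply _))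

/-- The trace kernel evaluated along a topological ordering: the marginal of the trace law on the
external output slots. -/
noncomputable def traceKernelAlong (us : List D.V) (h : D.IsTopologicalOrder us) :
    TupleKernel P.space :=
  ⟨D.inProfile, D.outProfile, (D.traceLaw us h.1).map (D.readOutput us h.2),
    have := D.isMarkovKernel_traceLaw us h.1
    ProbabilityTheory.Kernel.IsMarkovKernel.map _ (D.measurable_readOutput us h.2)⟩

theorem exists_isTopologicalOrder : ∃ us, D.IsTopologicalOrder us := by
  classical
  let r := Relation.TransGen (fun a b => ∃ w, (D.src w).1 = a ∧ (D.tgt w).1 = b)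
  have hwf : WellFounded r := by
    have : Std.Irrefl r := ⟨D.acyclic⟩
    have : IsTrans D.V r := ⟨fun _ _ _ => Relation.TransGen.trans⟩
    exact Finite.wellFounded_of_trans_of_irrefl r
  have key : ∀ (n : ℕ) (us : List D.V), D.IsInitial us →
      (Finset.univ.filter (· ∉ us)).card = n → ∃ us, D.IsTopologicalOrder us := by
    intro n
    induction n with
    | zero =>
      intro us hus hn
      refine ⟨us, hus, fun v => ?_⟩
      by_contra hv
      have := Finset.card_eq_zero.1 hn
      exact Finset.notMem_empty v (this ▸ by simpa using hv)
    | succ n ih =>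
      intro us hus hn
      have hne : {v | v ∉ us}.Nonempty := by
        obtain ⟨v, hv⟩ := Finset.card_pos.1 (by omega : 0 < (Finset.univ.filter (· ∉ us)).card)
        exact ⟨v, by simpa using hv⟩
      obtain ⟨v, hv, hmin⟩ := hwf.has_min _ hne
      refine ih (v :: us) ⟨hv, fun w hw => ?_, hus⟩ ?_
      · by_contra hc
        exact hmin _ hc (Relation.TransGen.single ⟨w, rfl, hw⟩)
      · have : Finset.univ.filter (· ∉ v :: us) = (Finset.univ.filter (· ∉ us)).erase v := by
          ext a
          simp
        rw [this, Finset.card_erase_of_mem (by simpa using hv), hn]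
        rfl
  exact key _ [] trivial rfl

/-- The trace kernel of a finite acyclic KSC diagram, evaluated along some topological ordering. -/
noncomputable def traceKernel : TupleKernel P.space :=
  D.traceKernelAlong D.exists_isTopologicalOrder.choose D.exists_isTopologicalOrder.choose_spec

end KSCDiagram

/-! ## Finite acyclic CKSC diagrams -/

section CKSC

variable {K : Type uK} [Category.{vK} K] {𝒞 : ColorSystem.{uK, vK, uM} K}

/-- A finite acyclic CKSC diagram in a CMP: as a KSC diagram, but the internal wire `w` carries an
admissible interface witness `wit w` from the object of its source slot to the object of its target
slot. The lists `ins` and `outs` are the chosen orderings of all external slots. -/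
structure CKSCDiagram (P : CMP.{uO, uS} 𝒞) where
  V : Type uD
  W : Type uD
  [fintypeV : Fintype V]
  [fintypeW : Fintype W]
  label : V → P.Mor
  src : W → V × ℕ
  tgt : W → V × ℕ
  wit : W → Arrow K
  src_lt : ∀ w, (src w).2 < (label (src w).1).cod.length
  tgt_lt : ∀ w, (tgt w).2 < (label (tgt w).1).dom.length
  wit_mem : ∀ w, wit w ∈ P.Int ((label (src w).1).cod[(src w).2]'(src_lt w))
    ((label (tgt w).1).dom[(tgt w).2]'(tgt_lt w))
  src_injective : Function.Injective src
  tgt_injective : Function.Injective tgt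
  acyclic : ∀ v, ¬ Relation.TransGen (fun a b => ∃ w, (src w).1 = a ∧ (tgt w).1 = b) v v
  ins : List (V × ℕ)
  outs : List (V × ℕ)
  nodup_ins : ins.Nodup
  nodup_outs : outs.Nodup
  mem_ins : ∀ s, s ∈ ins ↔ s.2 < (label s.1).dom.length ∧ ∀ w, tgt w ≠ s
  mem_outs : ∀ s, s ∈ outs ↔ s.2 < (label s.1).cod.length ∧ ∀ w, src w ≠ s

attribute [instance] CKSCDiagram.fintypeV CKSCDiagram.fintypeW

/-- Binary bracketings of vertices; `comp w E₂ E₁` stands for the composite of `E₂` with `E₁` along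
the internal wire `w`. -/
inductive Expr (V W : Type uD) : Type uD
  | vertex : V → Expr V W
  | comp : W → Expr V W → Expr V W → Expr V W

/-- The vertices occurring in an expression. -/
def Expr.vertices {V W : Type uD} : Expr V W → List V
  | vertex v => [v]
  | comp _ E₂ E₁ => E₂.vertices ++ E₁.vertices

/-- The internal wires occurring in an expression. -/
def Expr.wires {V W : Type uD} : Expr V W → List W
  | vertex _ => []
  | comp w E₂ E₁ => w :: (E₂.wires ++ E₁.wires)

namespace CKSCDiagram

variable {P : CMP.{uO, uS} 𝒞} (D : CKSCDiagram.{uO, uS, uK, vK, uM, uD} P)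

/-- The ordered input slots of a vertex. -/
def inSlots (v : D.V) : List (D.V × ℕ) := (List.range (D.label v).dom.length).map (Prod.mk v)

/-- The ordered output slots of a vertex. -/
def outSlots (v : D.V) : List (D.V × ℕ) := (List.range (D.label v).cod.length).map (Prod.mk v)

/-- `D.Evaluates E I O k`: the iterated CKSC expression `E` is well formed, its ordered unconnected
input and output slots are `I` and `O`, and its value is the morphism `k`. In the composition step
the output slot `src w` of `E₁` is connected to the input slot `tgt w` of `E₂`; the slots of an
expression are in positions corresponding to the entries of the profiles of its value. -/
inductive Evaluates : Expr D.V D.W → List (D.V × ℕ) → List (D.V × ℕ) → P.Mor → Prop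
  | vertex (v : D.V) : Evaluates (.vertex v) (D.inSlots v) (D.outSlots v) (D.label v)
  | comp (w : D.W) (E₂ E₁ : Expr D.V D.W) (I₁ I₂ J O O₁ O₂ : List (D.V × ℕ)) (l k : P.Mor)
      (B₁ : List P.Ob) (B : P.Ob) (B₂ C₁ : List P.Ob) (C : P.Ob) (C₂ : List P.Ob)
      (hk : k.cod = B₁ ++ B :: B₂) (hl : l.dom = C₁ ++ C :: C₂) (hf : D.wit w ∈ P.Int B C) :
      Evaluates E₂ (I₁ ++ D.tgt w :: I₂) O l →
      Evaluates E₁ J (O₁ ++ D.src w :: O₂) k →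
      B₁.length = O₁.length → C₁.length = I₁.length →
      Evaluates (.comp w E₂ E₁) (I₁ ++ (J ++ I₂)) (O₁ ++ (O ++ O₂))
        (CMP.cksc l k B₁ B B₂ C₁ C C₂ hk hl (D.wit w) hf)

/-- `E` is an iterated CKSC expression that realizes `D` and has value `k`: it is formed from the
vertices of `D`, each used once, it realizes all internal wires of `D`, and its ordered external
slots are those of `D`. -/
def IsReduction (E : Expr D.V D.W) (k : P.Mor) : Prop :=
  E.vertices.Nodup ∧ (∀ v, v ∈ E.vertices) ∧ (∀ w, w ∈ E.wires) ∧ D.Evaluates E D.ins D.outs k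

/-- CKSC-reducible diagrams. -/
def Reducible : Prop := ∃ (E : Expr D.V D.W) (k : P.Mor), D.IsReduction E k

variable {D} in
/-- The value `⟨D⟩` of a CKSC-reducible diagram: the value of some reduction expression. -/
noncomputable def Reducible.value (h : D.Reducible) : P.Mor := h.choose_spec.choose

/-- The interface vertex inserted on the internal wire `w`. -/
def interface (w : D.W) : P.Mor := P.κ _ _ (D.wit w) (D.wit_mem w)

/-- The interface expansion: the unary interface vertex `inr w` is inserted on every internal wire
`w`; the wire `inl w` leads into it and the wire `inr w` leads out of it. -/
def expansion : KSCDiagram.{uO, uS, uD} P.toMarkovPolycategory where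
  V := D.V ⊕ D.W
  W := D.W ⊕ D.W
  label := Sum.elim D.label D.interface
  src := Sum.elim (fun w => (Sum.inl (D.src w).1, (D.src w).2)) fun w => (Sum.inr w, 0)
  tgt := Sum.elim (fun w => (Sum.inr w, 0)) fun w => (Sum.inl (D.tgt w).1, (D.tgt w).2)
  src_lt := by
    rintro (w | w)
    · exact D.src_lt w
    · simp [interface, P.cod_κ]
  tgt_lt := by
    rintro (w | w)
    · simp [interface, P.dom_κ]
    · exact D.tgt_lt w
  obj_eq := by
    rintro (w | w) <;> simp [interface, P.cod_κ, P.dom_κ]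
  src_injective := by
    rintro (w | w) (w' | w') h <;> simp at h
    · exact congrArg _ (D.src_injective (Prod.ext h.1 h.2))
    · exact congrArg _ h
  tgt_injective := by
    rintro (w | w) (w' | w') h <;> simp at h
    · exact congrArg _ h
    · exact congrArg _ (D.tgt_injective (Prod.ext h.1 h.2))
  acyclic := by
    let e : D.V → D.V → Prop := fun a b => ∃ w, (D.src w).1 = a ∧ (D.tgt w).1 = b
    let s : D.V ⊕ D.W → D.V := Sum.elim id fun w => (D.src w).1
    let t : D.V ⊕ D.W → D.V := Sum.elim id fun w => (D.tgt w).1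
    have hst : ∀ x, Relation.ReflTransGen e (s x) (t x) := by
      rintro (v | w)
      · exact .refl
      · exact .single ⟨w, rfl, rfl⟩
    intro x hx
    have key : ∀ y, Relation.TransGen (fun a b : D.V ⊕ D.W => ∃ w : D.W ⊕ D.W,
        (Sum.elim (fun w => ((Sum.inl (D.src w).1 : D.V ⊕ D.W), (D.src w).2))
          (fun w => (Sum.inr w, 0)) w).1 = a ∧
        (Sum.elim (fun w => ((Sum.inr w : D.V ⊕ D.W), 0))
          (fun w => (Sum.inl (D.tgt w).1, (D.tgt w).2)) w).1 = b) x y →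
        Relation.ReflTransGen e (t x) (s y) ∧
          (x.isLeft → y.isLeft → Relation.TransGen e (t x) (s y)) := by
      intro y hy
      induction hy with
      | single h =>
        obtain ⟨w | w, rfl, rfl⟩ := h
        · exact ⟨.refl, by simp⟩
        · exact ⟨.refl, by simp⟩
      | tail hab h ih =>
        obtain ⟨w | w, rfl, rfl⟩ := h
        · exact ⟨ih.1, by simp⟩
        · exact ⟨ih.1.tail ⟨w, rfl, rfl⟩, fun _ _ => .tail' ih.1 ⟨w, rfl, rfl⟩⟩
    rcases x with v | w
    · exact D.acyclic v ((key _ hx).2 rfl rfl)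
    · exact D.acyclic _ (.head' ⟨w, rfl, rfl⟩ (key _ hx).1)
  ins := D.ins.map fun s => (Sum.inl s.1, s.2)
  outs := D.outs.map fun s => (Sum.inl s.1, s.2)
  nodup_ins := D.nodup_ins.map fun a b h => by simpa [Prod.ext_iff] using h
  nodup_outs := D.nodup_outs.map fun a b h => by simpa [Prod.ext_iff] using h
  mem_ins := by
    rintro ⟨v | w, p⟩
    · simp [D.mem_ins, Prod.ext_iff]
    · simp [interface, P.dom_κ]
      intro h
      omega
  mem_outs := by
    rintro ⟨v | w, p⟩
    · simp [D.mem_outs, Prod.ext_iff]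
    · simp [interface, P.cod_κ]
      intro h
      omega

/-- The trace kernel of a CKSC diagram: the trace kernel of its interface expansion. -/
noncomputable def traceKernel : TupleKernel P.space := D.expansion.traceKernel

/-- The image `G D` of a diagram under a CMP-functor: `G` is applied to every vertex label, and wires,
interface witnesses and the orderings of the external slots are unchanged. -/
def map {P P' : CMP.{uO, uS} 𝒞} (G : P ⟶ P') (D : CKSCDiagram.{uO, uS, uK, vK, uM, uD} P) :
    CKSCDiagram.{uO, uS, uK, vK, uM, uD} P' where
  V := D.V
  W := D.W
  label v := CMP.mapMor G (D.label v)
  src := D.src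
  tgt := D.tgt
  wit := D.wit
  src_lt w := by
    rw [CMP.mapMor, CMPFunctor.cod_map, List.length_map]
    exact D.src_lt w
  tgt_lt w := by
    rw [CMP.mapMor, CMPFunctor.dom_map, List.length_map]
    exact D.tgt_lt w
  wit_mem w := by
    simpa [CMP.mapMor, CMPFunctor.cod_map, CMPFunctor.dom_map] using
      CMPFunctor.int_obj G (D.wit_mem w)
  src_injective := D.src_injective
  tgt_injective := D.tgt_injective
  acyclic := D.acyclic
  ins := D.ins
  outs := D.outs
  nodup_ins := D.nodup_ins
  nodup_outs := D.nodup_outs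
  mem_ins s := by
    rw [CMP.mapMor, CMPFunctor.dom_map, List.length_map]
    exact D.mem_ins s
  mem_outs s := by
    rw [CMP.mapMor, CMPFunctor.cod_map, List.length_map]
    exact D.mem_outs s

end CKSCDiagram

end CKSC

end ColoredMarkov

open ColoredMarkov

/-! A morphism of a Markov polycategory is a Markov kernel together with its profiles, so two facts
suffice. Every reduction expression of a diagram evaluates to the trace kernel of the interface
expansion; and a CMP-functor turns an evaluation of an expression in `D` into an evaluation of the
same expression in `D.map G`. The first gives uniqueness of the value, because the trace kernel does
not mention the expression; the second makes the image diagram reducible, with the image of the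
value as its value; the first, applied to the image diagram, then identifies the underlying kernel.

For the first fact, sampling is described by operators on functions of a total assignment of values
to all output slots: `step` resamples one vertex, `run` a list of vertices. Total assignments avoid
types that depend on the list of vertices already sampled. Steps of two vertices not joined by a
wire commute by Tonelli (`step_comm`), hence `run` agrees along all linear extensions
(`run_eq_of_perm`), and `lintegral_traceLaw` identifies it with integration against the trace law.

The invariant `Realizes`, propagated by induction on expressions in `Evaluates.realizes`, says that
running the vertices of a subexpression is integration against its value. The test function may
depend on the rest of the assignment as a parameter. This lets `Realizes.comp` integrate out the
second kernel while the outputs of the first are held fixed, and afterwards the first kernel. The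
list `Expr.order` puts each interface vertex between the two factors it joins;
`Evaluates.pairwise_order` shows that it is compatible with all wires, so that
`Realizes.eq_traceKernelAlong` applies to a full expression. -/

namespace ColoredMarkov

open MeasureTheory ProbabilityTheory

/-! ## Reading tuples off families of tuples -/

section Gather

variable {Ob : Type uO} {S : Ob → Type uS}

/-- The first entry of a nonempty tuple. -/
def Tuple.head {X : Ob} {L : List Ob} (t : Tuple S (X :: L)) : S X := t.1

/-- The tuple with first entry `x` and remaining entries `t`. -/
def Tuple.cons {X : Ob} {L : List Ob} (x : S X) (t : Tuple S L) : Tuple S (X :: L) := (x, t)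

theorem Tuple.left_append : ∀ {L₁ L₂ : List Ob} (s : Tuple S L₁) (t : Tuple S L₂),
    (Tuple.append s t).left = s
  | [], _, _, _ => rfl
  | _ :: _, _, s, t => Prod.ext rfl (Tuple.left_append s.2 t)

theorem Tuple.right_append : ∀ {L₁ L₂ : List Ob} (s : Tuple S L₁) (t : Tuple S L₂),
    Tuple.right (Tuple.append s t) = t
  | [], _, _, _ => rfl
  | _ :: _, _, s, t => Tuple.right_append s.2 t

theorem Tuple.ext_get : ∀ {L : List Ob} {s t : Tuple S L},
    (∀ p h, s.get p h = t.get p h) → s = t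
  | [], _, _, _ => rfl
  | _ :: _, _, _, h => Prod.ext (h 0 (Nat.succ_pos _))
      (Tuple.ext_get fun p hp => h (p + 1) (Nat.succ_lt_succ hp))

theorem Tuple.get_ofFn : ∀ {L : List Ob} (f : ∀ (p : ℕ) (h : p < L.length), S L[p]) (p : ℕ)
    (h : p < L.length), (Tuple.ofFn f).get p h = f p h
  | _ :: _, _, 0, _ => rfl
  | _ :: _, f, p + 1, h =>
    Tuple.get_ofFn (fun p h => f (p + 1) (Nat.succ_lt_succ h)) p (Nat.lt_of_succ_lt_succ h)

theorem recast_recast {X Y Z : Ob} (e : X = Y) (e' : Y = Z) (s : S X) :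
    recast e' (recast e s) = recast (e.trans e') s := by
  subst e e'
  rfl

variable {V : Type uD} {lab : V → List Ob}

/-- The entry in the slot `s` of a family of tuples. -/
def slotValue (y : ∀ v, Tuple S (lab v)) (s : V × ℕ) {X : Ob}
    (h : (lab s.1)[s.2]? = some X) : S X :=
  recast (List.getElem?_eq_some_iff.1 h).2 ((y s.1).get s.2 (List.getElem?_eq_some_iff.1 h).1)

/-- The tuple of the entries in the slots of the list `O`. -/
def gather (y : ∀ v, Tuple S (lab v)) : ∀ (L : List Ob) (O : List (V × ℕ)),
    O.map (fun s => (lab s.1)[s.2]?) = L.map some → Tuple S L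
  | [], _, _ => PUnit.unit
  | _ :: L, s :: O, h => (slotValue y s (List.cons.inj h).1, gather y L O (List.cons.inj h).2)
  | _ :: _, [], h => absurd h (by simp)

/-- The hypothesis relating `O` and `L` records the range and the object of every slot in a single
equation of lists of optional objects; such equations split and concatenate without casts. -/
theorem gather_append (y : ∀ v, Tuple S (lab v)) : ∀ (L₁ L₂ : List Ob) (O₁ O₂ : List (V × ℕ))
    (h₁ : O₁.map (fun s => (lab s.1)[s.2]?) = L₁.map some)
    (h₂ : O₂.map (fun s => (lab s.1)[s.2]?) = L₂.map some)
    (h : (O₁ ++ O₂).map (fun s => (lab s.1)[s.2]?) = (L₁ ++ L₂).map some),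
    gather y (L₁ ++ L₂) (O₁ ++ O₂) h = Tuple.append (gather y L₁ O₁ h₁) (gather y L₂ O₂ h₂)
  | [], _, [], _, _, _, _ => rfl
  | [], _, _ :: _, _, h₁, _, _ => absurd h₁ (by simp)
  | _ :: _, _, [], _, h₁, _, _ => absurd h₁ (by simp)
  | _ :: L₁, L₂, _ :: O₁, O₂, h₁, h₂, h =>
    Prod.ext rfl (gather_append y L₁ L₂ O₁ O₂ (List.cons.inj h₁).2 h₂ (List.cons.inj h).2)

theorem gather_congr {y y' : ∀ v, Tuple S (lab v)} : ∀ (L : List Ob) (O : List (V × ℕ))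
    (h : O.map (fun s => (lab s.1)[s.2]?) = L.map some),
    (∀ s ∈ O, ∀ hs, (y s.1).get s.2 hs = (y' s.1).get s.2 hs) → gather y L O h = gather y' L O h
  | [], _, _, _ => rfl
  | _ :: _, [], h, _ => absurd h (by simp)
  | _ :: L, s :: O, h, H => Prod.ext
      (congrArg (recast _) (H s List.mem_cons_self _))
      (gather_congr L O (List.cons.inj h).2 fun s hs => H s (List.mem_cons_of_mem _ hs))

theorem getElem_of_map_eq {L : List Ob} {O : List (V × ℕ)}
    (h : O.map (fun s => (lab s.1)[s.2]?) = L.map some) (p : ℕ) (hp : p < O.length)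
    (hp' : p < L.length) : (lab O[p].1)[O[p].2]? = some L[p] := by
  have := List.getElem_of_eq h (i := p) (by simpa using hp)
  simpa using this

theorem get_gather (y : ∀ v, Tuple S (lab v)) : ∀ (L : List Ob) (O : List (V × ℕ))
    (h : O.map (fun s => (lab s.1)[s.2]?) = L.map some) (p : ℕ) (hp : p < L.length)
    (hp' : p < O.length),
    (gather y L O h).get p hp = slotValue y O[p] (getElem_of_map_eq h p hp' hp)
  | _ :: _, [], h, _, _, _ => absurd h (by simp)
  | _ :: _, _ :: _, _, 0, _, _ => rfl
  | _ :: L, _ :: O, h, p + 1, hp, hp' =>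
    get_gather y L O (List.cons.inj h).2 p (Nat.lt_of_succ_lt_succ hp) (Nat.lt_of_succ_lt_succ hp')

theorem slotValue_congr_slot (y : ∀ v, Tuple S (lab v)) {s s' : V × ℕ} (e : s = s') {X : Ob}
    (h : (lab s.1)[s.2]? = some X) (h' : (lab s'.1)[s'.2]? = some X) :
    slotValue y s h = slotValue y s' h' := by
  subst e
  rfl

theorem gather_slots (y : ∀ v, Tuple S (lab v)) (v : V)
    (h : ((List.range (lab v).length).map (Prod.mk v)).map (fun s => (lab s.1)[s.2]?) =
      (lab v).map some) :
    gather y (lab v) ((List.range (lab v).length).map (Prod.mk v)) h = y v := by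
  refine Tuple.ext_get fun p hp => ?_
  rw [get_gather _ _ _ _ _ _ (by simpa using hp),
    slotValue_congr_slot y (s' := (v, p)) (by simp) _ (by simp [hp])]
  rfl

theorem map_slots (v : V) :
    ((List.range (lab v).length).map (Prod.mk v)).map (fun s => (lab s.1)[s.2]?) =
      (lab v).map some := by
  refine List.ext_getElem (by simp) fun p hp hp' => ?_
  have : p < (lab v).length := by simpa using hp'
  simp [this]

variable [∀ X, MeasurableSpace (S X)]

theorem measurable_gather : ∀ (L : List Ob) (O : List (V × ℕ))
    (h : O.map (fun s => (lab s.1)[s.2]?) = L.map some),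
    Measurable fun y : ∀ v, Tuple S (lab v) => gather y L O h
  | [], _, _ => measurable_const
  | _ :: _, [], h => absurd h (by simp)
  | _ :: L, s :: O, h =>
    ((measurable_recast _).comp ((Tuple.measurable_get _ _).comp (measurable_pi_apply s.1))).prodMk
      (measurable_gather L O (List.cons.inj h).2)

/-- A slotwise composite is the pushforward of a composition-product, hence an iterated integral.
With the input already split into blocks, all projections in `kscInput` simplify. -/
theorem lintegral_kscKernel {A B₁ B₂ C₁ C₂ D : List Ob} {X : Ob}
    (l : Kernel (Tuple S (C₁ ++ X :: C₂)) (Tuple S D))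
    (k : Kernel (Tuple S A) (Tuple S (B₁ ++ X :: B₂)))
    [IsMarkovKernel l] [IsMarkovKernel k]
    {g : Tuple S (B₁ ++ (D ++ B₂)) → ENNReal} (hg : Measurable g)
    (c₁ : Tuple S C₁) (a : Tuple S A) (c₂ : Tuple S C₂) :
    ∫⁻ b, g b ∂kscKernel l k (Tuple.append c₁ (Tuple.append a c₂)) =
      ∫⁻ b, ∫⁻ d, g (kscOutput (b, d))
        ∂l (Tuple.append c₁ (Tuple.cons (Tuple.head b.right) c₂)) ∂k a := by
  unfold kscKernel
  rw [Kernel.lintegral_map _ measurable_kscOutput _ hg]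
  refine (Kernel.lintegral_compProd _ _ _ (hg.comp measurable_kscOutput)).trans ?_
  simp only [Kernel.comap_apply, Tuple.left_append, Tuple.right_append, Function.comp]
  refine lintegral_congr fun b => ?_
  simp only [kscInput, Tuple.left_append, Tuple.right_append]
  rfl

end Gather

/-! ## Sampling operators of a diagram -/

namespace KSCDiagram

variable {P : MarkovPolycategory.{uO, uS}} (D : KSCDiagram.{uO, uS, uD} P)

/-- Values of all output slots of all vertices. -/
abbrev Assignment : Type (max uD uS) := ∀ v, Tuple P.space (D.label v).cod

open Classical in
/-- The input tuples of all vertices, read off the external input and an assignment. -/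
noncomputable def inputs (z : Tuple P.space D.inProfile) (y : D.Assignment) (v : D.V) :
    Tuple P.space (D.label v).dom :=
  Tuple.ofFn fun q hq =>
    if hw : ∃ w, D.tgt w = (v, q) then
      recast (by
          rw [D.obj_eq hw.choose]
          have := hw.choose_spec
          congr! 3 <;> rw [this])
        ((y (D.src hw.choose).1).get (D.src hw.choose).2 (D.src_lt hw.choose))
    else
      have hs : D.ins.idxOf (v, q) < D.ins.length :=
        List.idxOf_lt_length_of_mem ((D.mem_ins (v, q)).2 ⟨hq, not_exists.1 hw⟩)
      recast (by simp [inProfile])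
        (z.get (D.ins.idxOf (v, q)) (by simpa [inProfile] using hs))

variable {D}

/-- A wired slot reads only the vertex at the source of its wire, and an external slot reads only
`z`. -/
theorem get_inputs_congr {z : Tuple P.space D.inProfile} {y y' : D.Assignment} {v : D.V} {q : ℕ}
    (hq : q < (D.label v).dom.length)
    (h : ∀ w, D.tgt w = (v, q) → y (D.src w).1 = y' (D.src w).1) :
    (D.inputs z y v).get q hq = (D.inputs z y' v).get q hq := by
  unfold inputs
  rw [Tuple.get_ofFn, Tuple.get_ofFn]
  by_cases hw : ∃ w, D.tgt w = (v, q)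
  · rw [dif_pos hw, dif_pos hw, h _ hw.choose_spec]
  · rw [dif_neg hw, dif_neg hw]

theorem inputs_congr {z : Tuple P.space D.inProfile} {y y' : D.Assignment} {v : D.V}
    (h : ∀ w, (D.tgt w).1 = v → y (D.src w).1 = y' (D.src w).1) :
    D.inputs z y v = D.inputs z y' v :=
  Tuple.ext_get fun _ hq => get_inputs_congr hq fun w hw => h w (by rw [hw])

theorem slotValue_inputs_tgt (z : Tuple P.space D.inProfile) (y : D.Assignment) (w : D.W)
    {X : P.Ob} (ht : (D.label (D.tgt w).1).dom[(D.tgt w).2]? = some X)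
    (hs : (D.label (D.src w).1).cod[(D.src w).2]? = some X) :
    slotValue (lab := fun v => (D.label v).dom) (D.inputs z y) (D.tgt w) ht =
      slotValue (lab := fun v => (D.label v).cod) y (D.src w) hs := by
  unfold slotValue inputs
  have hw : ∃ w', D.tgt w' = ((D.tgt w).1, (D.tgt w).2) := ⟨w, rfl⟩
  rw [Tuple.get_ofFn, dif_pos hw, recast_recast]
  -- The wire chosen in `inputs` equals `w` because targets are injective; quantifying over it makes
  -- the substitution possible in the dependent types.
  have key : ∀ (w' : D.W) (_ : w' = w) (h : (D.label (D.src w').1).cod[(D.src w').2]'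
      (D.src_lt w') = X) (h' : (D.label (D.src w).1).cod[(D.src w).2]' (D.src_lt w) = X),
      recast h ((y (D.src w').1).get (D.src w').2 (D.src_lt w')) =
        recast h' ((y (D.src w).1).get (D.src w).2 (D.src_lt w)) := by
    rintro w' rfl _ _
    rfl
  exact key _ (D.tgt_injective hw.choose_spec) _ _

theorem map_ins_eq :
    D.ins.map (fun s => (D.label s.1).dom[s.2]?) = D.inProfile.map some := by
  refine List.ext_getElem (by simp [inProfile]) fun p hp hp' => ?_
  have : p < D.ins.length := by simpa using hp
  have h := ((D.mem_ins D.ins[p]).1 (List.getElem_mem _)).1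
  simp [inProfile, h]

theorem map_outs_eq :
    D.outs.map (fun s => (D.label s.1).cod[s.2]?) = D.outProfile.map some := by
  refine List.ext_getElem (by simp [outProfile]) fun p hp hp' => ?_
  have : p < D.outs.length := by simpa using hp
  have h := ((D.mem_outs D.outs[p]).1 (List.getElem_mem _)).1
  simp [outProfile, h]

-- External slots carry no wire, so they always read `z`; as `D.ins` has no repetition, `idxOf`
-- recovers the original position.
open Classical in
theorem gather_inputs_ins (z : Tuple P.space D.inProfile) (y : D.Assignment) :
    gather (D.inputs z y) D.inProfile D.ins map_ins_eq = z := by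
  refine Tuple.ext_get fun p hp => ?_
  have hp' : p < D.ins.length := by simpa [inProfile] using hp
  rw [get_gather _ _ _ _ _ _ hp']
  unfold slotValue inputs
  have hw : ¬ ∃ w, D.tgt w = ((D.ins[p]).1, (D.ins[p]).2) := fun ⟨w, hw⟩ =>
    ((D.mem_ins D.ins[p]).1 (List.getElem_mem _)).2 w hw
  rw [Tuple.get_ofFn, dif_neg hw, recast_recast]
  have key : ∀ (i : ℕ) (_ : i = p) (hi : i < D.inProfile.length)
      (h : D.inProfile[i] = D.inProfile[p]), recast h (z.get i hi) = z.get p hp := by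
    rintro i rfl _ _
    rfl
  exact key _ (D.nodup_ins.idxOf_getElem p hp') _ _

theorem gather_outs (us : List D.V) (hus : ∀ v, v ∈ us) (o : D.Outputs us) :
    gather (lab := fun v => (D.label v).cod) (fun v => o ⟨v, hus v⟩) D.outProfile D.outs
      map_outs_eq = D.readOutput us hus o := by
  refine Tuple.ext_get fun p hp => ?_
  have hp' : p < D.outs.length := by simpa [outProfile] using hp
  rw [get_gather _ _ _ _ _ _ hp']
  unfold readOutput
  rw [Tuple.get_ofFn]
  rfl

theorem measurable_inputs (z : Tuple P.space D.inProfile) (v : D.V) :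
    Measurable fun y => D.inputs z y v := by
  refine Tuple.measurable_ofFn fun q hq => ?_
  by_cases hw : ∃ w, D.tgt w = (v, q)
  · simp only [hw, dite_true]
    exact (measurable_recast _).comp ((Tuple.measurable_get _ _).comp (measurable_pi_apply _))
  · simp only [hw, dite_false]
    exact measurable_const

theorem measurable_inputs_pi (z : Tuple P.space D.inProfile) : Measurable (D.inputs z) :=
  measurable_pi_iff.2 (measurable_inputs z)

open Classical in
/-- The expectation of `f` after resampling the outputs of the vertex `v`. -/
noncomputable def step (z : Tuple P.space D.inProfile) (v : D.V) (f : D.Assignment → ENNReal)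
    (y : D.Assignment) : ENNReal :=
  ∫⁻ b, f (Function.update y v b) ∂(D.label v).ker (D.inputs z y v)

/-- The expectation of `f` after resampling the vertices in a list, latest vertex first. -/
noncomputable def run (z : Tuple P.space D.inProfile) :
    List D.V → (D.Assignment → ENNReal) → D.Assignment → ENNReal
  | [], f => f
  | v :: us, f => run z us (step z v f)

theorem run_append (z : Tuple P.space D.inProfile) : ∀ (us us' : List D.V)
    (f : D.Assignment → ENNReal), run z (us ++ us') f = run z us' (run z us f)
  | [], _, _ => rfl
  | v :: us, us', f => run_append z us us' (step z v f)

open Classical in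
theorem measurable_update_prod (v : D.V) :
    Measurable fun p : D.Assignment × Tuple P.space (D.label v).cod =>
      Function.update p.1 v p.2 := by
  refine measurable_pi_iff.2 fun u => ?_
  by_cases h : u = v
  · subst h
    simpa using measurable_snd
  · simp only [Function.update_of_ne h]
    exact (measurable_pi_apply u).comp measurable_fst

theorem measurable_step (z : Tuple P.space D.inProfile) (v : D.V) {f : D.Assignment → ENNReal}
    (hf : Measurable f) : Measurable (step z v f) :=
  Measurable.lintegral_kernel_prod_right'
    (κ := (D.label v).ker.comap (fun y => D.inputs z y v) (measurable_inputs z v))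
    (hf.comp (measurable_update_prod v))

/-! ### Independence of the topological ordering -/

/-- There is no wire from `a` to `b`. -/
def NoEdge (a b : D.V) : Prop := ∀ w, (D.src w).1 = a → (D.tgt w).1 ≠ b

/-- Without a wire between them, neither vertex reads the output of the other, so the two samples
are independent given the remaining values. -/
theorem step_comm (z : Tuple P.space D.inProfile) {u v : D.V} (huv : u ≠ v) (h : NoEdge u v)
    (h' : NoEdge v u) {f : D.Assignment → ENNReal} (hf : Measurable f) :
    step z u (step z v f) = step z v (step z u f) := by
  classical
  funext y
  have hi : ∀ {a b : D.V}, NoEdge a b → ∀ x,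
      D.inputs z (Function.update y a x) b = D.inputs z y b := fun hab x =>
    inputs_congr fun w hw => Function.update_of_ne (fun e => hab w e hw) _ _
  unfold step
  simp only [hi h, hi h']
  -- Neither measure now depends on the other integration variable, so Tonelli applies.
  rw [lintegral_lintegral_swap]
  · simp only [Function.update_comm huv]
  · refine (hf.comp ?_).aemeasurable
    exact (measurable_update_prod v).comp
      (((measurable_update_prod u).comp (measurable_const.prodMk measurable_fst)).prodMk
        measurable_snd)

/-- Repeated use of `step_comm`: this is the bubble-sort move behind `run_eq_of_perm`. -/
theorem run_append_cons (z : Tuple P.space D.inProfile) (v : D.V) : ∀ (as bs : List D.V)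
    {f : D.Assignment → ENNReal}, Measurable f →
    (∀ a ∈ as, a ≠ v ∧ NoEdge a v ∧ NoEdge v a) →
    run z (as ++ v :: bs) f = run z (v :: (as ++ bs)) f
  | [], _, _, _, _ => rfl
  | a :: as, bs, f, hf, h => by
    obtain ⟨h₁, h₂, h₃⟩ := h a List.mem_cons_self
    rw [List.cons_append, run, run_append_cons z v as bs (measurable_step z a hf)
      fun b hb => h b (List.mem_cons_of_mem _ hb)]
    simp only [run, List.cons_append]
    rw [step_comm z h₁ h₂ h₃ hf]

/-- The sampling operator does not depend on the topological ordering. -/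
theorem run_eq_of_perm (z : Tuple P.space D.inProfile) : ∀ {us us' : List D.V}
    {f : D.Assignment → ENNReal}, Measurable f → us.Nodup → us.Pairwise NoEdge →
    us'.Pairwise NoEdge → us.Perm us' → run z us f = run z us' f
  | [], us', f, _, _, _, _, hp => by rw [hp.nil_eq]
  | v :: us, us', f, hf, hn, hu, hu', hp => by
    obtain ⟨as, bs, rfl⟩ := List.append_of_mem (hp.subset List.mem_cons_self)
    have hp' : us.Perm (as ++ bs) := List.Perm.cons_inv (hp.trans List.perm_middle)
    have has : ∀ a ∈ as, a ∈ us := fun a ha => hp'.symm.subset (List.mem_append_left _ ha)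
    -- Each vertex of `as` stands before `v` in `us'` and after `v` in `us`, so the two pairwise
    -- conditions exclude wires in both directions.
    rw [run_append_cons z v as bs hf fun a ha => ⟨fun e => (List.nodup_cons.1 hn).1 (e ▸ has a ha),
      (List.pairwise_append.1 hu').2.2 a ha v List.mem_cons_self,
      (List.pairwise_cons.1 hu).1 a (has a ha)⟩, run, run]
    refine run_eq_of_perm z (measurable_step z v hf) (List.nodup_cons.1 hn).2
      (List.pairwise_cons.1 hu).2 (hu'.sublist ?_) hp'
    exact (List.sublist_cons_self v bs).append_left as

/-! ## Trace laws and sampling operators -/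

theorem IsInitial.src_mem : ∀ {us : List D.V}, D.IsInitial us → ∀ w, (D.tgt w).1 ∈ us →
    (D.src w).1 ∈ us
  | _ :: _, h, w, hw => by
    rcases List.mem_cons.1 hw with e | hw
    · exact List.mem_cons_of_mem _ (h.2.1 w e)
    · exact List.mem_cons_of_mem _ (IsInitial.src_mem h.2.2 w hw)

/-- An initial list is closed under predecessors, so a wire from its head into the tail would put
the head into the tail. -/
theorem IsInitial.pairwise : ∀ {us : List D.V}, D.IsInitial us → us.Pairwise NoEdge
  | [], _ => List.Pairwise.nil
  | _ :: _, h => List.pairwise_cons.2 ⟨fun _ hb w hs ht =>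
      h.1 (hs ▸ IsInitial.src_mem h.2.2 w (ht ▸ hb)), IsInitial.pairwise h.2.2⟩

theorem IsInitial.nodup : ∀ {us : List D.V}, D.IsInitial us → us.Nodup
  | [], _ => List.nodup_nil
  | _ :: _, h => List.nodup_cons.2 ⟨h.1, IsInitial.nodup h.2.2⟩

open Classical in
/-- Overwrite the assignment `y` by the outputs of the vertices in `us`. -/
noncomputable def glue {us : List D.V} (y : D.Assignment) (o : D.Outputs us) : D.Assignment :=
  fun v => if h : v ∈ us then o ⟨v, h⟩ else y v

theorem measurable_glue {us : List D.V} (y : D.Assignment) :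
    Measurable (glue (us := us) y) := by
  refine measurable_pi_iff.2 fun v => ?_
  by_cases h : v ∈ us
  · simp only [glue, h, dite_true]
    exact measurable_pi_apply _
  · simp only [glue, h, dite_false]
    exact measurable_const

open Classical in
theorem glue_extendOutputs {us : List D.V} (y : D.Assignment) (v : D.V)
    (o : D.Outputs us) (b : Tuple P.space (D.label v).cod) :
    glue y (D.extendOutputs v us (o, b)) = Function.update (glue y o) v b := by
  funext u
  by_cases h : v = u
  · subst h
    simp [glue, extendOutputs]
  · have h' : u ≠ v := fun e => h e.symm
    by_cases hu : u ∈ us <;> simp [glue, extendOutputs, h, h', hu, Function.update_of_ne]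

/-- All predecessors of `v` lie in `us`, so the background assignment `y` is never read. -/
theorem inputs_glue {us : List D.V} (z : Tuple P.space D.inProfile) (y : D.Assignment) (v : D.V)
    (h : ∀ w, (D.tgt w).1 = v → (D.src w).1 ∈ us) (o : D.Outputs us) :
    D.inputs z (glue y o) v = D.readInput v us h (z, o) := by
  unfold inputs readInput
  congr 1
  funext q hq
  by_cases hw : ∃ w, D.tgt w = (v, q)
  · rw [dif_pos hw, dif_pos hw]
    congr 2
    exact dif_pos (h _ (by rw [hw.choose_spec]))
  · rw [dif_neg hw, dif_neg hw]

/-- The bridge between the trace law, whose type depends on `us`, and the operators on total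
assignments: adjoining the latest vertex to the law is one `step` on the test function. -/
theorem lintegral_traceLaw (z : Tuple P.space D.inProfile) (y : D.Assignment) :
    ∀ (us : List D.V) (h : D.IsInitial us) {f : D.Assignment → ENNReal}, Measurable f →
      ∫⁻ o, f (glue y o) ∂D.traceLaw us h z = run z us f y
  | [], _, f, hf => by
    unfold traceLaw
    refine (Kernel.lintegral_deterministic' _ (hf.comp (measurable_glue y))).trans ?_
    refine congrArg f ?_
    funext v
    simp [glue]
  | v :: us, h, f, hf => by
    have := D.isMarkovKernel_traceLaw us h.2.2
    unfold traceLaw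
    refine (Kernel.lintegral_map _ (D.measurable_extendOutputs v us) _
      (hf.comp (measurable_glue y))).trans ?_
    refine (Kernel.lintegral_compProd _ _ _
      ((hf.comp (measurable_glue y)).comp (D.measurable_extendOutputs v us))).trans ?_
    simp only [Function.comp, Kernel.comap_apply, glue_extendOutputs, ← inputs_glue z y v h.2.1]
    exact lintegral_traceLaw z y us h.2.2 (measurable_step z v hf)

end KSCDiagram

/-! ## Kernels realized by sampling operators -/

section Tuples

variable {Ob : Type uO} {S : Ob → Type uS}

theorem kscOutput_append {B₁ B₂ D : List Ob} {X : Ob} (b₁ : Tuple S B₁) (x : S X)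
    (b₂ : Tuple S B₂) (d : Tuple S D) :
    kscOutput (Tuple.append b₁ (Tuple.cons x b₂), d) = Tuple.append b₁ (Tuple.append d b₂) := by
  simp only [kscOutput, Tuple.left_append, Tuple.right_append]
  rfl

variable [∀ X, MeasurableSpace (S X)]

theorem Tuple.measurable_head {X : Ob} {L : List Ob} :
    Measurable (Tuple.head : Tuple S (X :: L) → S X) := measurable_fst

theorem Tuple.measurable_cons {X : Ob} {L : List Ob} :
    Measurable (fun p : S X × Tuple S L => Tuple.cons p.1 p.2) := measurable_id

end Tuples

namespace KSCDiagram

variable {P : MarkovPolycategory.{uO, uS}} {D : KSCDiagram.{uO, uS, uD} P}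

/-- Sampling the vertices in `us` (latest first) and reading the output slots `O` amounts to
sampling from the kernel `k` with inputs read from the input slots `I`, jointly with everything
that does not depend on the outputs of the vertices in `us`. -/
structure Realizes (D : KSCDiagram.{uO, uS, uD} P) (us : List D.V) (I O : List (D.V × ℕ))
    (k : TupleKernel P.space) : Prop where
  dom : I.map (fun s => (D.label s.1).dom[s.2]?) = k.dom.map some
  cod : O.map (fun s => (D.label s.1).cod[s.2]?) = k.cod.map some
  out_mem : ∀ s ∈ O, s.1 ∈ us
  run_eq : ∀ (z : Tuple P.space D.inProfile) (g : Tuple P.space k.cod → D.Assignment → ENNReal),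
    Measurable (Function.uncurry g) →
    (∀ b y y', (∀ v ∉ us, y v = y' v) → g b y = g b y') → ∀ y,
    run z us (fun y => g (gather (lab := fun v => (D.label v).cod) y k.cod O cod) y) y =
      ∫⁻ b, g b y ∂k.ker
        (gather (lab := fun v => (D.label v).dom) (D.inputs z y) k.dom I dom)

-- For a single vertex the statement is the definition of `step`; the parameter of the test function
-- ignores the value at `v`, so the update there is harmless.
open Classical in
theorem realizes_vertex (v : D.V) :
    D.Realizes [v] ((List.range (D.label v).dom.length).map (Prod.mk v))
      ((List.range (D.label v).cod.length).map (Prod.mk v)) (D.label v).toKernel where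
  dom := map_slots (lab := fun v => (D.label v).dom) v
  cod := map_slots (lab := fun v => (D.label v).cod) v
  out_mem := by simp
  run_eq z g hg hgi y := by
    have h₁ := fun y h => gather_slots (lab := fun v => (D.label v).dom) (S := P.space) y v h
    have h₂ := fun y h => gather_slots (lab := fun v => (D.label v).cod) (S := P.space) y v h
    simp only [run, step]
    refine Eq.trans ?_ (congrArg (fun t => ∫⁻ b, g b y ∂(D.label v).ker t) (h₁ _ _).symm)
    refine lintegral_congr fun b => ?_
    refine (congrArg (fun t => g t _) ((h₂ _ _).trans (Function.update_self v b y))).trans ?_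
    exact hgi _ _ _ fun u hu => Function.update_of_ne (by simpa using hu) _ _

/-- The later vertices `us₂` are integrated out first, giving a test function for `us₁`. By `hdisj`,
resampling `us₂` leaves the outputs of `us₁` alone; by `hI`, the inputs of `l` other than the
connected one do not depend on `us₁`. -/
theorem Realizes.comp {us₁ us₂ : List D.V} {I₁ I₂ J O O₁ O₂ : List (D.V × ℕ)}
    {l k : TupleKernel P.space} (w : D.W)
    (Hl : D.Realizes us₂ (I₁ ++ D.tgt w :: I₂) O l)
    (Hk : D.Realizes us₁ J (O₁ ++ D.src w :: O₂) k)
    {B₁ : List P.Ob} {X : P.Ob} {B₂ C₁ C₂ : List P.Ob}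
    (hk : k.cod = B₁ ++ X :: B₂) (hl : l.dom = C₁ ++ X :: C₂)
    (hB : B₁.length = O₁.length) (hC : C₁.length = I₁.length)
    (hdisj : ∀ v ∈ us₁, v ∉ us₂)
    (hI : ∀ w', D.tgt w' ∈ I₁ ++ I₂ → (D.src w').1 ∉ us₁) :
    D.Realizes (us₂ ++ us₁) (I₁ ++ (J ++ I₂)) (O₁ ++ (O ++ O₂))
      (l.comp k B₁ X B₂ C₁ C₂ hk hl) := by
  obtain ⟨A, _, k, _⟩ := k
  obtain ⟨_, E, l, _⟩ := l
  dsimp only at hk hl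
  subst hk hl
  obtain ⟨hdl, hcl, hol, hrl⟩ := Hl
  obtain ⟨hdk, hck, hok, hrk⟩ := Hk
  dsimp only at hdl hcl hdk hck hrl hrk
  have hdl' := hdl
  have hck' := hck
  rw [List.map_append, List.map_append] at hdl' hck'
  -- The length hypotheses align the slot lists with the profiles, so both split at the connected
  -- slot.
  obtain ⟨hI₁, hXI₂⟩ := List.append_inj hdl' (by simp [hC])
  obtain ⟨hO₁, hXO₂⟩ := List.append_inj hck' (by simp [hB])
  obtain ⟨hXI, hI₂⟩ := List.cons.inj hXI₂
  obtain ⟨hXO, hO₂⟩ := List.cons.inj hXO₂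
  have hJI₂ : (J ++ I₂).map (fun s => (D.label s.1).dom[s.2]?) = (A ++ C₂).map some := by
    rw [List.map_append, List.map_append, hdk, hI₂]
  have hOO₂ : (O ++ O₂).map (fun s => (D.label s.1).cod[s.2]?) = (E ++ B₂).map some := by
    rw [List.map_append, List.map_append, hcl, hO₂]
  have hdom : (I₁ ++ (J ++ I₂)).map (fun s => (D.label s.1).dom[s.2]?) =
      (C₁ ++ (A ++ C₂)).map some := by
    simp only [List.map_append, hI₁, hdk, hI₂]
  have hcod : (O₁ ++ (O ++ O₂)).map (fun s => (D.label s.1).cod[s.2]?) =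
      (B₁ ++ (E ++ B₂)).map some := by
    simp only [List.map_append, hO₁, hcl, hO₂]
  refine ⟨hdom, hcod, ?_, ?_⟩
  · intro s hs
    simp only [List.mem_append] at hs ⊢
    rcases hs with hs | hs | hs
    · exact Or.inr (hok s (by simp [hs]))
    · exact Or.inl (hol s hs)
    · exact Or.inr (hok s (by simp [hs]))
  intro z g hg hgi y
  change Tuple P.space (B₁ ++ (E ++ B₂)) → D.Assignment → ENNReal at g
  change run z (us₂ ++ us₁)
      (fun y => g (gather (lab := fun v => (D.label v).cod) y _ _ hcod) y) y =
    ∫⁻ b, g b y ∂kscKernel l k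
      (gather (lab := fun v => (D.label v).dom) (D.inputs z y) _ _ hdom)
  let c₁ : D.Assignment → Tuple P.space C₁ := fun y =>
    gather (lab := fun v => (D.label v).dom) (D.inputs z y) C₁ I₁ hI₁
  let c₂ : D.Assignment → Tuple P.space C₂ := fun y =>
    gather (lab := fun v => (D.label v).dom) (D.inputs z y) C₂ I₂ hI₂
  let b₁ : D.Assignment → Tuple P.space B₁ := fun y =>
    gather (lab := fun v => (D.label v).cod) y B₁ O₁ hO₁
  let b₂ : D.Assignment → Tuple P.space B₂ := fun y =>
    gather (lab := fun v => (D.label v).cod) y B₂ O₂ hO₂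
  have mb₁ : Measurable b₁ := measurable_gather _ _ _
  have mb₂ : Measurable b₂ := measurable_gather _ _ _
  have mc₁ : Measurable c₁ := (measurable_gather _ _ _).comp (measurable_inputs_pi z)
  have mc₂ : Measurable c₂ := (measurable_gather _ _ _).comp (measurable_inputs_pi z)
  let input : Tuple P.space (B₁ ++ X :: B₂) → D.Assignment → Tuple P.space (C₁ ++ X :: C₂) :=
    fun b y => Tuple.append (c₁ y) (Tuple.cons (Tuple.head b.right) (c₂ y))
  have minput : Measurable (Function.uncurry input) := by
    refine Tuple.measurable_append.comp (Measurable.prodMk (mc₁.comp measurable_snd) ?_)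
    exact Tuple.measurable_cons.comp (Measurable.prodMk
      ((Tuple.measurable_head.comp Tuple.measurable_right).comp measurable_fst)
      (mc₂.comp measurable_snd))
  -- What remains of `g` once `l` is integrated out: the connected input comes from the sample `b`
  -- of `k`, the other inputs from the assignment.
  let g₂ : Tuple P.space (B₁ ++ X :: B₂) → D.Assignment → ENNReal := fun b y =>
    ∫⁻ d, g (kscOutput (b, d)) y ∂l (input b y)
  have mg₂ : Measurable (Function.uncurry g₂) := by
    refine Measurable.lintegral_kernel_prod_right'
      (κ := l.comap (Function.uncurry input) minput)
      (f := fun p => g (kscOutput (p.1.1, p.2)) p.1.2) ?_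
    refine hg.comp (Measurable.prodMk (measurable_kscOutput.comp ?_) ?_)
    · exact (measurable_fst.comp measurable_fst).prodMk measurable_snd
    · exact measurable_snd.comp measurable_fst
  have hc : ∀ {L : List P.Ob} {I : List (D.V × ℕ)}
      (h : I.map (fun s => (D.label s.1).dom[s.2]?) = L.map some),
      (∀ s ∈ I, s ∈ I₁ ++ I₂) → ∀ {y y' : D.Assignment}, (∀ v ∉ us₁, y v = y' v) →
      gather (lab := fun v => (D.label v).dom) (D.inputs z y) L I h =
        gather (lab := fun v => (D.label v).dom) (D.inputs z y') L I h := by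
    intro L I h hI' y y' hy
    refine gather_congr _ _ _ fun s hs hq => get_inputs_congr hq fun w' hw' => hy _ (hI w' ?_)
    rw [hw']
    exact hI' s hs
  have key : run z us₂ (fun y => g (gather (lab := fun v => (D.label v).cod) y _ _ hcod) y) =
      fun y => g₂ (gather (lab := fun v => (D.label v).cod) y _ _ hck) y := by
    funext y
    have e₁ : (fun y => g (gather (lab := fun v => (D.label v).cod) y _ _ hcod) y) =
        fun y => g (Tuple.append (b₁ y) (Tuple.append
          (gather (lab := fun v => (D.label v).cod) y _ _ hcl) (b₂ y))) y := by
      funext y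
      rw [gather_append _ _ _ _ _ hO₁ hOO₂, gather_append _ _ _ _ _ hcl hO₂]
    rw [e₁]
    -- The unconnected outputs `b₁ y` and `b₂ y` of the first factor enter as parameters of the test
    -- function for `l`.
    refine (hrl z (fun d y => g (Tuple.append (b₁ y) (Tuple.append d (b₂ y))) y) ?_ ?_ y).trans ?_
    · refine hg.comp (Measurable.prodMk ?_ measurable_snd)
      exact Tuple.measurable_append.comp ((mb₁.comp measurable_snd).prodMk
        (Tuple.measurable_append.comp (measurable_fst.prodMk (mb₂.comp measurable_snd))))
    · intro d y y' hy
      have hb : ∀ {L : List P.Ob} {I : List (D.V × ℕ)}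
          (h : I.map (fun s => (D.label s.1).cod[s.2]?) = L.map some),
          (∀ s ∈ I, s ∈ O₁ ++ D.src w :: O₂) →
          gather (lab := fun v => (D.label v).cod) y L I h =
            gather (lab := fun v => (D.label v).cod) y' L I h := fun h hI' =>
        gather_congr _ _ _ fun s hs hq => by rw [hy _ (hdisj _ (hok s (hI' s hs)))]
      have h₁ : b₁ y = b₁ y' := hb hO₁ fun s hs => by simp [hs]
      have h₂ : b₂ y = b₂ y' := hb hO₂ fun s hs => by simp [hs]
      simp only [h₁, h₂]
      exact hgi _ _ _ fun v hv => hy v fun hv' => hv (List.mem_append_left _ hv')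
    · have e₂ : gather (lab := fun v => (D.label v).cod) y _ _ hck =
          Tuple.append (b₁ y) (Tuple.cons (slotValue (lab := fun v => (D.label v).cod) y _ hXO)
            (b₂ y)) := gather_append _ _ _ _ _ hO₁ hXO₂ _
      have e₃ : gather (lab := fun v => (D.label v).dom) (D.inputs z y) _ _ hdl =
          input (gather (lab := fun v => (D.label v).cod) y _ _ hck) y := by
        simp only [input, e₂, Tuple.right_append]
        refine (gather_append _ _ _ _ _ hI₁ hXI₂ _).trans ?_
        refine congrArg (Tuple.append _) ?_
        -- Here the wire `w` is used: its target slot reads its source slot.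
        exact Prod.ext (slotValue_inputs_tgt z y w hXI hXO) rfl
      simp only [g₂, ← e₃]
      simp only [e₂, kscOutput_append]
  rw [run_append, key]
  refine (hrk z g₂ mg₂ ?_ y).trans ?_
  · intro b y y' hy
    have h₁ : c₁ y = c₁ y' := hc hI₁ (fun s hs => by simp [hs]) hy
    have h₂ : c₂ y = c₂ y' := hc hI₂ (fun s hs => by simp [hs]) hy
    simp only [g₂, input, h₁, h₂]
    refine lintegral_congr fun d => hgi _ _ _ fun v hv => hy v fun hv' => ?_
    exact hv (List.mem_append_right _ hv')
  · rw [gather_append _ _ _ _ _ hI₁ hJI₂, gather_append _ _ _ _ _ hdk hI₂]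
    exact (lintegral_kscKernel l k
      (hg.comp (measurable_id.prodMk measurable_const) : Measurable fun b => g b y) _ _ _).symm

/-- A kernel realized on all vertices along a topological ordering is the trace kernel along
every topological ordering. -/
theorem Realizes.eq_traceKernelAlong {us : List D.V} {k : TupleKernel P.space}
    (H : D.Realizes us D.ins D.outs k) (hn : us.Nodup) (hm : ∀ v, v ∈ us)
    (hp : us.Pairwise NoEdge) (us' : List D.V) (h' : D.IsTopologicalOrder us') :
    k = D.traceKernelAlong us' h' := by
  obtain ⟨hdom, hcod, -, hrun⟩ := H
  obtain ⟨A, B, k, _⟩ := k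
  dsimp only at hdom hcod hrun
  -- The ordered external slots determine the profiles, since `some` is injective.
  obtain rfl : A = D.inProfile :=
    List.map_injective_iff.2 (Option.some_injective _) (hdom.symm.trans map_ins_eq)
  obtain rfl : B = D.outProfile :=
    List.map_injective_iff.2 (Option.some_injective _) (hcod.symm.trans map_outs_eq)
  have key : k = (D.traceLaw us' h'.1).map (D.readOutput us' h'.2) := by
    ext z s hs
    have := D.isMarkovKernel_traceLaw us' h'.1
    -- A probability measure has a nonempty sample space, which supplies a starting assignment for
    -- `run`; every value of it gets overwritten.
    obtain ⟨o⟩ := nonempty_of_isProbabilityMeasure (D.traceLaw us' h'.1 z)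
    let y : D.Assignment := fun v => o ⟨v, h'.2 v⟩
    let G : Tuple P.space D.outProfile → ENNReal := s.indicator 1
    have hG : Measurable G := measurable_one.indicator hs
    let f : D.Assignment → ENNReal := fun y =>
      G (gather (lab := fun v => (D.label v).cod) y _ _ hcod)
    have hf : Measurable f := hG.comp (measurable_gather _ _ _)
    have e := hrun z (fun b _ => G b) (hG.comp measurable_fst) (fun _ _ _ _ => rfl) y
    rw [gather_inputs_ins, lintegral_indicator_one hs] at e
    rw [← e, run_eq_of_perm z hf hn hp h'.1.pairwise
      ((List.perm_ext_iff_of_nodup hn h'.1.nodup).2 fun v => by simp [hm, h'.2]),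
      ← lintegral_traceLaw z y us' h'.1 hf, ← lintegral_indicator_one hs]
    refine Eq.trans ?_ (Kernel.lintegral_map _ (D.measurable_readOutput us' h'.2) _ hG).symm
    refine lintegral_congr fun o' => ?_
    simp only [f]
    rw [← gather_outs]
    congr 2
    funext v
    simp [glue, h'.2 v]
  subst key
  rfl

end KSCDiagram

/-! ## Values of reduction expressions -/

section Reduction

variable {K : Type uK} [Category.{vK} K] {𝒞 : ColorSystem.{uK, vK, uM} K}

/-- The vertices of the interface expansion occurring in an expression, latest first. -/
def Expr.order {V W : Type uD} : Expr V W → List (V ⊕ W)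
  | vertex v => [Sum.inl v]
  | comp w E₂ E₁ => E₂.order ++ Sum.inr w :: E₁.order

theorem Expr.inl_mem_order {V W : Type uD} {v : V} : ∀ {E : Expr V W},
    Sum.inl v ∈ E.order ↔ v ∈ E.vertices
  | vertex _ => by simp [order, vertices]
  | comp _ E₂ E₁ => by simp [order, vertices, inl_mem_order (E := E₁), inl_mem_order (E := E₂)]

theorem Expr.inr_mem_order {V W : Type uD} {w : W} : ∀ {E : Expr V W},
    Sum.inr w ∈ E.order ↔ w ∈ E.wires
  | vertex _ => by simp [order, wires]
  | comp _ E₂ E₁ => by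
    simp [order, wires, inr_mem_order (E := E₁), inr_mem_order (E := E₂), or_left_comm]

namespace CKSCDiagram

variable {P : CMP.{uO, uS} 𝒞} {D : CKSCDiagram.{uO, uS, uK, vK, uM, uD} P}

theorem Evaluates.mem_vertices {E I O k} (h : D.Evaluates E I O k) :
    (∀ s ∈ I, s.1 ∈ E.vertices) ∧ (∀ s ∈ O, s.1 ∈ E.vertices) := by
  induction h with
  | vertex v => simp [inSlots, outSlots, Expr.vertices]
  | comp w E₂ E₁ I₁ I₂ J O O₁ O₂ l k B₁ B B₂ C₁ C C₂ hk hl hf h₂ h₁ hB hC ih₂ ih₁ =>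
    simp only [Expr.vertices, List.mem_append, List.mem_cons] at *
    grind

/-- The endpoints of a composed wire are free slots of the two factors, hence slots of their
vertices. -/
theorem Evaluates.wire_mem {E I O k} (h : D.Evaluates E I O k) :
    ∀ w ∈ E.wires, (D.src w).1 ∈ E.vertices ∧ (D.tgt w).1 ∈ E.vertices := by
  induction h with
  | vertex v => simp [Expr.wires]
  | comp w E₂ E₁ I₁ I₂ J O O₁ O₂ l k B₁ B B₂ C₁ C C₂ hk hl hf h₂ h₁ hB hC ih₂ ih₁ =>
    have hs := h₁.mem_vertices.2 (D.src w) (by simp)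
    have ht := h₂.mem_vertices.1 (D.tgt w) (by simp)
    simp only [Expr.vertices, Expr.wires, List.mem_append, List.mem_cons] at *
    grind

theorem Evaluates.nodup_inSlots {E I O k} (h : D.Evaluates E I O k) (hE : E.vertices.Nodup) :
    I.Nodup := by
  induction h with
  | vertex v => exact List.nodup_range.map fun a b h => (Prod.ext_iff.1 h).2
  | comp w E₂ E₁ I₁ I₂ J O O₁ O₂ l k B₁ B B₂ C₁ C C₂ hk hl hf h₂ h₁ hB hC ih₂ ih₁ =>
    obtain ⟨hE₂, hE₁, hd⟩ := List.nodup_append.1 hE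
    have n₂ := ih₂ hE₂
    have n₁ := ih₁ hE₁
    have m₂ := h₂.mem_vertices.1
    have m₁ := h₁.mem_vertices.1
    simp only [List.nodup_append, List.mem_append, List.mem_cons, List.nodup_cons] at *
    grind

/-- No wire can be used twice: a wire joining disjoint factors has an endpoint outside each of them,
so it occurs in neither, and the two factors share no wire. -/
theorem Evaluates.nodup_order {E I O k} (h : D.Evaluates E I O k) (hE : E.vertices.Nodup) :
    E.order.Nodup := by
  induction h with
  | vertex v => simp [Expr.order]
  | comp w E₂ E₁ I₁ I₂ J O O₁ O₂ l k B₁ B B₂ C₁ C C₂ hk hl hf h₂ h₁ hB hC ih₂ ih₁ =>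
    obtain ⟨hE₂, hE₁, hd⟩ := List.nodup_append.1 hE
    have hs := h₁.mem_vertices.2 (D.src w) (by simp)
    have ht := h₂.mem_vertices.1 (D.tgt w) (by simp)
    have hw₂ : w ∉ E₂.wires := fun hw => hd _ (h₂.wire_mem w hw).1 _ hs rfl
    have hw₁ : w ∉ E₁.wires := fun hw => hd _ ht _ (h₁.wire_mem w hw).2 rfl
    refine List.nodup_append.2 ⟨ih₂ hE₂,
      List.nodup_cons.2 ⟨fun hw => hw₁ (Expr.inr_mem_order.1 hw), ih₁ hE₁⟩, ?_⟩
    rintro (v | w') ha _ hb rfl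
    · have hb : Sum.inl v ∈ E₁.order := by simpa using hb
      exact hd _ (Expr.inl_mem_order.1 ha) _ (Expr.inl_mem_order.1 hb) rfl
    · rcases List.mem_cons.1 hb with e | hb
      · cases e
        exact hw₂ (Expr.inr_mem_order.1 ha)
      · exact hd _ (h₂.wire_mem w' (Expr.inr_mem_order.1 ha)).1 _
          (h₁.wire_mem w' (Expr.inr_mem_order.1 hb)).1 rfl

theorem noEdge_expansion {a b : D.V ⊕ D.W}
    (h₁ : ∀ w, a = Sum.inl (D.src w).1 → b ≠ Sum.inr w)
    (h₂ : ∀ w, a = Sum.inr w → b ≠ Sum.inl (D.tgt w).1) :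
    KSCDiagram.NoEdge (D := D.expansion) a b := by
  rintro (w | w) hs ht
  · exact h₁ w hs.symm ht.symm
  · exact h₂ w hs.symm ht.symm

/-- Only interface vertices of wires composed in `E` occur in the order. Those inside a factor have
both endpoints there, and the one at the root leads from `E₁` to `E₂`, so nothing leads backwards.
-/
theorem Evaluates.pairwise_order {E I O k} (h : D.Evaluates E I O k) (hE : E.vertices.Nodup) :
    E.order.Pairwise (KSCDiagram.NoEdge (D := D.expansion)) := by
  induction h with
  | vertex v => exact List.pairwise_singleton _ _
  | comp w E₂ E₁ I₁ I₂ J O O₁ O₂ l k B₁ B B₂ C₁ C C₂ hk hl hf h₂ h₁ hB hC ih₂ ih₁ =>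
    obtain ⟨hE₂, hE₁, hd⟩ := List.nodup_append.1 hE
    have hs := h₁.mem_vertices.2 (D.src w) (by simp)
    have ht := h₂.mem_vertices.1 (D.tgt w) (by simp)
    refine List.pairwise_append.2 ⟨ih₂ hE₂, List.pairwise_cons.2 ⟨fun b hb => ?_, ih₁ hE₁⟩, ?_⟩
    · refine noEdge_expansion (fun w' e => by simp at e) fun w' e e' => ?_
      cases e
      subst e'
      exact hd _ ht _ (Expr.inl_mem_order.1 hb) rfl
    · intro a ha b hb
      rcases List.mem_cons.1 hb with rfl | hb
      · refine noEdge_expansion (fun w' e e' => ?_) fun w' _ e' => by simp at e'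
        cases e'
        subst e
        exact hd _ (Expr.inl_mem_order.1 ha) _ hs rfl
      · refine noEdge_expansion (fun w' e e' => ?_) fun w' e e' => ?_
        · subst e e'
          exact hd _ (Expr.inl_mem_order.1 ha) _
            (h₁.wire_mem w' (Expr.inr_mem_order.1 hb)).1 rfl
        · subst e e'
          exact hd _ (h₂.wire_mem w' (Expr.inr_mem_order.1 ha)).2 _
            (Expr.inl_mem_order.1 hb) rfl

/-! ### Reduction expressions compute trace kernels -/

/-- A slot of a vertex of `D` as a slot of the interface expansion. -/
def expandSlot (s : D.V × ℕ) : D.expansion.V × ℕ := (Sum.inl s.1, s.2)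

theorem realizes_interface (w : D.W) :
    D.expansion.Realizes [Sum.inr w] [(Sum.inr w, 0)] [(Sum.inr w, 0)]
      (D.interface w).toKernel := by
  have h := KSCDiagram.realizes_vertex (D := D.expansion) (Sum.inr w)
  have hd : (D.expansion.label (Sum.inr w)).dom.length = 1 :=
    congrArg List.length (P.dom_κ _ _ (D.wit w) (D.wit_mem w))
  have hc : (D.expansion.label (Sum.inr w)).cod.length = 1 :=
    congrArg List.length (P.cod_κ _ _ (D.wit w) (D.wit_mem w))
  rw [hd, hc] at h
  exact h

/-- The objects in a composition step are those found at the ends of the wire, so its interface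
kernel is the label of the inserted vertex. -/
theorem κ_eq_interface (w : D.W) {B C : P.Ob}
    (hB : (D.label (D.src w).1).cod[(D.src w).2]? = some B)
    (hC : (D.label (D.tgt w).1).dom[(D.tgt w).2]? = some C) (hf : D.wit w ∈ P.Int B C) :
    P.κ B C (D.wit w) hf = D.interface w := by
  obtain ⟨_, rfl⟩ := List.getElem?_eq_some_iff.1 hB
  obtain ⟨_, rfl⟩ := List.getElem?_eq_some_iff.1 hC
  rfl

/-- A colored composite is two slotwise composites, so `Realizes.comp` is applied twice in the
expansion: along the wire into the interface vertex, then along the wire out of it. -/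
theorem Evaluates.realizes {E I O k} (h : D.Evaluates E I O k) (hE : E.vertices.Nodup) :
    D.expansion.Realizes E.order (I.map expandSlot) (O.map expandSlot) k.toKernel := by
  induction h with
  | vertex v =>
    have h := KSCDiagram.realizes_vertex (D := D.expansion) (Sum.inl v)
    have e : ∀ n, ((List.range n).map (Prod.mk v)).map (expandSlot (D := D)) =
        (List.range n).map (Prod.mk (Sum.inl v)) := fun n => List.map_map
    unfold inSlots outSlots
    rw [e, e]
    exact h
  | comp w E₂ E₁ I₁ I₂ J O O₁ O₂ l k B₁ B B₂ C₁ C C₂ hk hl hf h₂ h₁ hB hC ih₂ ih₁ =>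
    obtain ⟨hE₂, hE₁, hd⟩ := List.nodup_append.1 hE
    have ht := h₂.mem_vertices.1
    have hs := h₁.mem_vertices.2 (D.src w) (by simp)
    have hn := h₂.nodup_inSlots hE₂
    have H₂ := ih₂ hE₂
    have H₁ := ih₁ hE₁
    rw [List.map_append, List.map_cons] at H₁ H₂
    rw [List.map_append, List.map_append, List.map_append, List.map_append]
    have hB' : (D.label (D.src w).1).cod[(D.src w).2]? = some B := by
      have := KSCDiagram.Realizes.cod H₁
      rw [show k.toKernel.cod = _ from hk, List.map_append, List.map_append] at this
      exact (List.cons.inj (List.append_inj this (by simp [hB])).2).1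
    have hC' : (D.label (D.tgt w).1).dom[(D.tgt w).2]? = some C := by
      have := KSCDiagram.Realizes.dom H₂
      rw [show l.toKernel.dom = _ from hl, List.map_append, List.map_append] at this
      exact (List.cons.inj (List.append_inj this (by simp [hC])).2).1
    have Hκ := realizes_interface w
    rw [← κ_eq_interface w hB' hC' hf] at Hκ
    have Hm := KSCDiagram.Realizes.comp (D := D.expansion) (I₁ := []) (I₂ := []) (C₁ := [])
      (C₂ := []) (Sum.inl w) Hκ H₁ hk (P.dom_κ B C (D.wit w) hf) (by simpa using hB) rfl
      (fun v hv hv' => by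
        rw [List.mem_singleton.1 hv'] at hv
        exact hd _ (ht (D.tgt w) (by simp)) _ (h₁.wire_mem w (Expr.inr_mem_order.1 hv)).2 rfl)
      (fun w' hw' => by simp at hw')
    rw [List.nil_append, List.append_nil] at Hm
    have Hc := KSCDiagram.Realizes.comp (D := D.expansion) (Sum.inr w) H₂ Hm
      (k := ((P.κ B C (D.wit w) hf).comp k B₁ B B₂ [] [] hk (P.dom_κ B C _ hf)).toKernel)
      (B₁ := B₁) (X := C) (B₂ := B₂) (C₁ := C₁) (C₂ := C₂)
      (by
        refine (MarkovPolycategory.Mor.cod_comp _ _ _ _ _ _ _ _ _).trans ?_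
        rw [P.cod_κ]
        rfl) hl (by simpa using hB) (by simpa using hC)
      (by
        rintro (v | w') hv hv'
        · have hv := (List.mem_cons.1 hv).resolve_left Sum.inl_ne_inr
          exact hd _ (Expr.inl_mem_order.1 hv') _ (Expr.inl_mem_order.1 hv) rfl
        · have hw₂ := h₂.wire_mem w' (Expr.inr_mem_order.1 hv')
          rcases List.mem_cons.1 hv with e | hv
          · cases e
            exact hd _ hw₂.1 _ hs rfl
          · exact hd _ hw₂.1 _ (h₁.wire_mem w' (Expr.inr_mem_order.1 hv)).1 rfl)
      (by
        -- No other input slot of `E₂` is fed by the earlier vertices. A wire `inl w'` ends at an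
        -- interface vertex. A wire `inr w'` ends at `D.tgt w'`: for `w' = w` the slot would be
        -- repeated in the free inputs of `E₂`, and for `w'` in `E₁` it would be a slot of a vertex
        -- of `E₁`.
        rintro (w' | w') hw' hv
        · rw [← List.map_append] at hw'
          obtain ⟨s, -, e⟩ := List.mem_map.1 hw'
          exact Sum.inl_ne_inr (congrArg Prod.fst e)
        · rw [← List.map_append] at hw'
          obtain ⟨s, hs', e⟩ := List.mem_map.1 hw'
          obtain rfl : s = D.tgt w' :=
            Prod.ext (Sum.inl_injective (congrArg Prod.fst e)) (congrArg Prod.snd e :)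
          rcases List.mem_cons.1 hv with e | hv
          · cases e
            have := List.perm_middle.nodup_iff.1 hn
            exact (List.nodup_cons.1 this).1 hs'
          · refine hd _ (ht (D.tgt w') ?_) _ (h₁.wire_mem w' (Expr.inr_mem_order.1 hv)).2 rfl
            simp only [List.mem_append, List.mem_cons] at hs' ⊢
            tauto)
    exact Hc

theorem IsReduction.toKernel_eq {E k} (h : D.IsReduction E k) (us : List D.expansion.V)
    (hus : D.expansion.IsTopologicalOrder us) :
    k.toKernel = D.expansion.traceKernelAlong us hus := by
  obtain ⟨hn, hv, hw, he⟩ := h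
  refine KSCDiagram.Realizes.eq_traceKernelAlong (he.realizes hn) (he.nodup_order hn) ?_
    (he.pairwise_order hn) us hus
  rintro (v | w)
  · exact Expr.inl_mem_order.2 (hv v)
  · exact Expr.inr_mem_order.2 (hw w)

/-- Both values have the same trace kernel underlying them, and a morphism is determined by its
kernel with profiles. -/
theorem IsReduction.unique {E E' k k'} (h : D.IsReduction E k) (h' : D.IsReduction E' k') :
    k = k' := by
  obtain ⟨us, hus⟩ := D.expansion.exists_isTopologicalOrder
  exact Subtype.ext ((h.toKernel_eq us hus).trans (h'.toKernel_eq us hus).symm)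

theorem Reducible.exists_isReduction_value (h : D.Reducible) : ∃ E, D.IsReduction E h.value :=
  ⟨h.choose, h.choose_spec.choose_spec⟩

/-! ## Images under CMP-functors -/

variable {P' : CMP.{uO, uS} 𝒞}

/-- Two uses of `map_comp` and one of `map_κ`; the witness is the same arrow on both sides. -/
theorem mapMor_cksc (G : P ⟶ P') (l k : P.Mor) (B₁ : List P.Ob) (B : P.Ob) (B₂ C₁ : List P.Ob)
    (C : P.Ob) (C₂ : List P.Ob) (hk : k.cod = B₁ ++ B :: B₂) (hl : l.dom = C₁ ++ C :: C₂)
    (f : Arrow K) (hf : f ∈ P.Int B C)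
    (hk' : (CMP.mapMor G k).cod = B₁.map (CMPFunctor.obj G) ++ CMPFunctor.obj G B ::
      B₂.map (CMPFunctor.obj G))
    (hl' : (CMP.mapMor G l).dom = C₁.map (CMPFunctor.obj G) ++ CMPFunctor.obj G C ::
      C₂.map (CMPFunctor.obj G)) :
    CMP.mapMor G (CMP.cksc l k B₁ B B₂ C₁ C C₂ hk hl f hf) =
      CMP.cksc (CMP.mapMor G l) (CMP.mapMor G k) _ _ _ _ _ _ hk' hl' f
        (CMPFunctor.int_obj G hf) := by
  unfold CMP.cksc CMP.mapMor
  rw [CMPFunctor.map_comp]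
  congr 1
  rw [CMPFunctor.map_comp]
  congr 1
  exact CMPFunctor.map_κ G B C f hf

/-- Induction on the evaluation. The expression and the slot lists stay literally the same, because
`G` preserves the lengths of profiles. -/
theorem Evaluates.map (G : P ⟶ P') {E I O k} (h : D.Evaluates E I O k) :
    (D.map G).Evaluates E I O (CMP.mapMor G k) := by
  induction h with
  | vertex v =>
    have h := Evaluates.vertex (D := D.map G) v
    have hi : (D.map G).inSlots v = D.inSlots v := by
      simp [inSlots, CKSCDiagram.map, CMP.mapMor, CMPFunctor.dom_map]
    have ho : (D.map G).outSlots v = D.outSlots v := by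
      simp [outSlots, CKSCDiagram.map, CMP.mapMor, CMPFunctor.cod_map]
    rw [hi, ho] at h
    exact h
  | comp w E₂ E₁ I₁ I₂ J O O₁ O₂ l k B₁ B B₂ C₁ C C₂ hk hl hf h₂ h₁ hB hC ih₂ ih₁ =>
    have hk' : (CMP.mapMor G k).cod = B₁.map (CMPFunctor.obj G) ++ CMPFunctor.obj G B ::
        B₂.map (CMPFunctor.obj G) := by
      rw [CMP.mapMor, CMPFunctor.cod_map, hk, List.map_append, List.map_cons]
    have hl' : (CMP.mapMor G l).dom = C₁.map (CMPFunctor.obj G) ++ CMPFunctor.obj G C ::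
        C₂.map (CMPFunctor.obj G) := by
      rw [CMP.mapMor, CMPFunctor.dom_map, hl, List.map_append, List.map_cons]
    rw [mapMor_cksc G l k B₁ B B₂ C₁ C C₂ hk hl _ hf hk' hl']
    exact Evaluates.comp (D := D.map G) w E₂ E₁ I₁ I₂ J O O₁ O₂ _ _ _ _ _ _ _ _ hk' hl'
      (CMPFunctor.int_obj G hf) ih₂ ih₁ ((List.length_map _).trans hB) ((List.length_map _).trans hC)

theorem IsReduction.map (G : P ⟶ P') {E k} (h : D.IsReduction E k) :
    (D.map G).IsReduction E (CMP.mapMor G k) :=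
  ⟨h.1, h.2.1, h.2.2.1, h.2.2.2.map G⟩

theorem Reducible.exists_map_value (G : P ⟶ P') (h : D.Reducible) :
    ∃ h' : (D.map G).Reducible, CMP.mapMor G h.value = h'.value := by
  obtain ⟨E, hE⟩ := h.exists_isReduction_value
  have hG : (D.map G).Reducible := ⟨E, _, hE.map G⟩
  obtain ⟨_, hE'⟩ := hG.exists_isReduction_value
  exact ⟨hG, (hE.map G).unique hE'⟩

end CKSCDiagram

end Reduction

end ColoredMarkov

/-! ### Assembly of the proposition -/

theorem mainTheorem7 {K : Type uK} [Category.{vK} K] (𝒞 : ColorSystem.{uK, vK, uM} K) :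
    -- CMP-functors preserve CKSC reductions and their values
    (∀ (P P' : CMP.{uO, uS} 𝒞) (G : P ⟶ P') (D : CKSCDiagram.{uO, uS, uK, vK, uM, uD} P)
        (hD : D.Reducible),
      -- the value of `D` does not depend on the reduction expression
      (∀ E k, D.IsReduction E k → k = hD.value) ∧
      ∃ hGD : (D.map G).Reducible,
        CMP.mapMor G hD.value = hGD.value ∧
        -- the kernel underlying `G⟨D⟩` is the trace kernel of `G D`, for every topological order
        (CMP.mapMor G hD.value).toKernel = (D.map G).traceKernel ∧
        ∀ (us : List (D.map G).expansion.V)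
          (hus : (D.map G).expansion.IsTopologicalOrder us),
          (CMP.mapMor G hD.value).toKernel = (D.map G).expansion.traceKernelAlong us hus) ∧
    -- functoriality of state pushforwards, for a state functor on an indexing category
    (∀ (T : Type uT) [Category.{vT} T] (F : T ⥤ CMP.{uO, uS} 𝒞),
      (∀ (t : T) (D : CKSCDiagram.{uO, uS, uK, vK, uM, uD} (F.obj t)),
        D.map (F.map (𝟙 t)) = D) ∧
      (∀ (t t' t'' : T) (α : t ⟶ t') (β : t' ⟶ t'')
        (D : CKSCDiagram.{uO, uS, uK, vK, uM, uD} (F.obj t)),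
        D.map (F.map (α ≫ β)) = (D.map (F.map α)).map (F.map β)) ∧
      ∀ (t t' : T) (α : t ⟶ t') (D : CKSCDiagram.{uO, uS, uK, vK, uM, uD} (F.obj t))
        (hD : D.Reducible),
        ∃ hD' : (D.map (F.map α)).Reducible, CMP.mapMor (F.map α) hD.value = hD'.value) := by
  refine ⟨fun P P' G D hD => ⟨fun E k h => ?_, ?_⟩, fun T _ F => ⟨fun t D => ?_, ?_, ?_⟩⟩
  · obtain ⟨_, h'⟩ := hD.exists_isReduction_value
    exact h.unique h'
  · obtain ⟨hG, e⟩ := hD.exists_map_value G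
    obtain ⟨_, h⟩ := hD.exists_isReduction_value
    -- `traceKernel` is evaluated along a chosen ordering, so it is an instance of the statement for
    -- all orderings.
    exact ⟨hG, e, (h.map G).toKernel_eq _ (D.map G).expansion.exists_isTopologicalOrder.choose_spec,
      (h.map G).toKernel_eq⟩
  · rw [F.map_id]
    -- The identity functor fixes every label definitionally, and the remaining fields are data left
    -- unchanged or proofs.
    rfl
  · intro t t' t'' α β D
    rw [F.map_comp]
    rfl
  · intro t t' α D hD
    exact hD.exists_map_value (F.map α)
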